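/- There is an absolute constant $C$ with the following property. Let $H_1,H_2$ be complex Hilbert spaces, let $E_1$ and $E_2$ be Borel spectral measures on $\mathbb R$ acting in $H_1$ and $H_2$ respectively (i.e. countably additive, in the strong operator topology, orthogonal-projection-valued functions of Borel subsets of $\mathbb R$ with $E_i(\mathbb R)=I$), let $f:\mathbb R\to\mathbb C$ be a Lipschitz function with $\|f\|_{\mathrm{Lip}}=\sup_{x\ne y}\frac{|f(x)-f(y)|}{|x-y|}$, and let $T:H_2\to H_1$ be a bounded linear operator of rank one. Then the double operator integral $$Q=\iint_{\mathbb R\times\mathbb R}\frac{f(x)-f(y)}{x-y}\,dE_1(x)\,T\,dE_2(y)$$ exists as a bounded operator from $H_2$ to $H_1$, where the divided difference is taken to be $0$ on the diagonal $x=y$. Here $Q$ is the unique bounded operator such that, for all $g\in H_2$ and $h\in H_1$, $$\langle Qg,h\rangle=\int_{\mathbb R^2}\frac{f(x)-f(y)}{x-y}\,dm_{g,h}(x,y),$$ where $m_{g,h}$ is the complex Borel measure on $\mathbb R^2$ with $m_{g,h}(\Lambda\times\Delta)=\langle E_1(\Lambda)TE_2(\Delta)g,h\rangle$ for all Borel sets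 $\Lambda,\Delta\subset\mathbb R$. Moreover, $Q$ belongs to the weak trace class $\boldsymbol S_{1,\infty}$, and $$\|Q\|_{\boldsymbol S_{1,\infty}}:=\sup_{j\ge0}(1+j)\,s_j(Q)\le C\,\|f\|_{\mathrm{Lip}}\,\|T\|,$$ where $s_j(Q)=\inf\{\|Q-R\|:\ R:H_2\to H_1\text{ bounded},\ \operatorname{rank}R\le j\}$ are the singular numbers of $Q$, and $\boldsymbol S_{1,\infty}$ is the set of bounded operators for which this supremum is finite. -/

import Mathlib

open MeasureTheory
open scoped ENNReal NNReal

/-- A Borel spectral measure on `ℝ` acting in the Hilbert space `H`: an orthogonal-projection-valued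
function of Borel sets, countably additive in the strong operator topology, with total mass the
identity operator. (Values on non-Borel sets play no role.) -/
structure BorelSpectralMeasure (H : Type*) [NormedAddCommGroup H] [InnerProductSpace ℂ H]
    [CompleteSpace H] where
  proj : Set ℝ → H →L[ℂ] H
  isStarProjection : ∀ Λ, MeasurableSet Λ → IsStarProjection (proj Λ)
  proj_empty : proj ∅ = 0
  proj_univ : proj Set.univ = 1
  proj_inter : ∀ Λ Δ, MeasurableSet Λ → MeasurableSet Δ → proj (Λ ∩ Δ) = proj Λ * proj Δ
  hasSum_iUnion : ∀ Λ : ℕ → Set ℝ, (∀ i, MeasurableSet (Λ i)) →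
    Pairwise (Function.onFun Disjoint Λ) →
    ∀ v : H, HasSum (fun i => proj (Λ i) v) (proj (⋃ i, Λ i) v)

/-- The divided difference `(f x - f y) / (x - y)`, equal to zero on the diagonal. -/
noncomputable def dividedDifference (f : ℝ → ℂ) (p : ℝ × ℝ) : ℂ :=
  if p.1 = p.2 then 0 else (f p.1 - f p.2) / ((p.1 : ℂ) - (p.2 : ℂ))

/-- The Lipschitz seminorm `sup_{x ≠ y} |f x - f y| / |x - y|`, as an extended nonnegative real. -/
noncomputable def lipSeminorm (f : ℝ → ℂ) : ℝ≥0∞ :=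
  ⨆ (x : ℝ) (y : ℝ) (_ : x ≠ y), ENNReal.ofReal (‖f x - f y‖ / |x - y|)

section Operators

variable {H₁ H₂ : Type*} [NormedAddCommGroup H₁] [InnerProductSpace ℂ H₁] [CompleteSpace H₁]
  [NormedAddCommGroup H₂] [InnerProductSpace ℂ H₂] [CompleteSpace H₂]

/-- `Q` is the double operator integral `∬ Φ(x, y) dE₁(x) T dE₂(y)`: for all vectors `g`, `h`, the
set function `Λ × Δ ↦ ⟨E₁(Λ) T E₂(Δ) g, h⟩` on Borel rectangles extends to a complex Borel measure
`m` on `ℝ × ℝ`, the function `Φ` is integrable with respect to `m`, and `⟨Q g, h⟩ = ∫ Φ dm`.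
The measure `m` is determined by its values on rectangles, hence `Q` is determined by this property.
(Mathlib's `inner ℂ h v` is linear in `v`.) -/
def IsDoubleOperatorIntegral (E₁ : BorelSpectralMeasure H₁) (E₂ : BorelSpectralMeasure H₂)
    (Φ : ℝ × ℝ → ℂ) (T Q : H₂ →L[ℂ] H₁) : Prop :=
  ∀ (g : H₂) (h : H₁), ∃ m : ComplexMeasure (ℝ × ℝ),
    (∀ Λ Δ : Set ℝ, MeasurableSet Λ → MeasurableSet Δ →
      m (Λ ×ˢ Δ) = inner ℂ h (E₁.proj Λ (T (E₂.proj Δ g)))) ∧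
    VectorMeasure.Integrable m Φ ∧
    inner ℂ h (Q g) = VectorMeasure.integral m Φ (ContinuousLinearMap.mul ℝ ℂ)

/-- The singular number `s_j(T)`, `j ≥ 0`: the distance in operator norm from `T` to the operators
of rank at most `j`. -/
noncomputable def singularNumber (T : H₂ →L[ℂ] H₁) (j : ℕ) : ℝ≥0∞ :=
  ⨅ (R : H₂ →L[ℂ] H₁) (_ : (R : H₂ →ₗ[ℂ] H₁).rank ≤ (j : Cardinal)), ‖T - R‖ₑ

/-- The quasinorm `sup_{j ≥ 0} (1 + j) s_j(T)` of the weak trace class. -/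
noncomputable def weakTraceQuasinorm (T : H₂ →L[ℂ] H₁) : ℝ≥0∞ :=
  ⨆ j : ℕ, singularNumber T j * (1 + (j : ℝ≥0∞))

/-- Membership in the weak trace class. -/
def MemWeakTraceClass (T : H₂ →L[ℂ] H₁) : Prop :=
  weakTraceQuasinorm T < ∞

end Operators

/-! Write `T g = c ⟨v, g⟩ u` with unit vectors `u`, `v`. The scalar spectral measures `μ` of `E₁` at
`u` and `ν` of `E₂` at `v` are probability measures, and `Λ ↦ E₁(Λ)u`, `Δ ↦ E₂(Δ)v` induce
contractions `V`, `W` from `L²(μ)`, `L²(ν)` into the two Hilbert spaces. Then `Q = c V K W*`, where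
`K : L²(ν) → L²(μ)` is the integral operator whose kernel is the divided difference
(`isDoubleOperatorIntegral_of_rank_one`). It remains to prove `s_j(K) ≤ C L / (1 + j)` for arbitrary
probability measures on the line, `L` being the Lipschitz constant.

Choose breakpoints so that the open intervals between them, and the two tails, have mass `O(1/N)`
for both measures. On each box freeze the variable lying in the shorter interval at an endpoint.
This yields a sum of `O(N)` product kernels; the breakpoints, which may be atoms, are treated
exactly by `O(N)` further products. Freezing costs `O(L d / s)`, where `d` is the shorter length and
`s` the distance from the far end of the shorter interval to the near end of the other (`s = d` on
the diagonal). For a fixed interval, the sum of `(d / s)²` over all intervals that are not shorter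
telescopes to an absolute constant (`sum_intervalWeight_le`). As each box has mass `O(1/N²)`, the
squared `L²` error is only `O(L²/N)`.

An operator with kernel of `L²` norm `ε` is within `ε / √(N + 1)` of rank `N`. Spending `N` more
ranks on the error thus improves `O(L/√N)` to `O(L/N)`, at total rank `O(N)`. -/

/-! ### Finite-rank approximation from a Hilbert–Schmidt bound -/

section FiniteRankApproximation

variable {X Y : Type*} [NormedAddCommGroup X] [InnerProductSpace ℂ X]
  [NormedAddCommGroup Y] [InnerProductSpace ℂ Y]

theorem rank_comp_le_finrank {F : Type*} [AddCommGroup F] [Module ℂ F] [FiniteDimensional ℂ F]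
    (g : X →ₗ[ℂ] F) (f : F →ₗ[ℂ] Y) : (f ∘ₗ g).rank ≤ (Module.finrank ℂ F : Cardinal) := by
  refine (LinearMap.rank_comp_le_left _ _).trans ?_
  rw [LinearMap.rank, ← Module.finrank_eq_rank]
  exact_mod_cast LinearMap.finrank_range_le f

/-- Greedy choice: if `F` is the span of the vectors found so far, then `A P_F` has rank at most
`N`, so `A (1 - P_F)` still has norm above `t`. A vector witnessing this, projected onto `Fᗮ` and
normalised, comes next. -/
theorem exists_orthonormal_lt_norm_apply (A : X →L[ℂ] Y) {t : ℝ} {N : ℕ}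
    (hA : ∀ R : X →L[ℂ] Y, (R : X →ₗ[ℂ] Y).rank ≤ (N : Cardinal) → t < ‖A - R‖) (ht : 0 ≤ t)
    (n : ℕ) (hn : n ≤ N + 1) :
    ∃ e : Fin n → X, Orthonormal ℂ e ∧ ∀ i, t < ‖A (e i)‖ := by
  induction n with
  | zero => exact ⟨Fin.elim0, ⟨fun i => i.elim0, fun i => i.elim0⟩, fun i => i.elim0⟩
  | succ n ih =>
    obtain ⟨e, he, hAe⟩ := ih (by omega)
    set F := Submodule.span ℂ (Set.range e) with hF
    have : FiniteDimensional ℂ F := FiniteDimensional.span_of_finite ℂ (Set.finite_range e)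
    have hrank : ((A ∘L F.starProjection : X →L[ℂ] Y) : X →ₗ[ℂ] Y).rank ≤ (N : Cardinal) := by
      have h2 : ((A ∘L F.starProjection : X →L[ℂ] Y) : X →ₗ[ℂ] Y)
          = (A.toLinearMap ∘ₗ F.subtype) ∘ₗ (F.orthogonalProjectionOnto : X →ₗ[ℂ] F) := rfl
      rw [h2]
      refine (rank_comp_le_finrank _ _).trans ?_
      have := finrank_range_le_card (R := ℂ) e
      simp only [Fintype.card_fin, Set.finrank] at this
      exact_mod_cast this.trans (by omega)
    have hlt := hA _ hrank
    obtain ⟨x, hx⟩ : ∃ x, t * ‖x‖ < ‖(A - A ∘L F.starProjection) x‖ := by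
      by_contra! h
      exact absurd (ContinuousLinearMap.opNorm_le_bound _ ht h) (not_le.2 hlt)
    set z := x - F.starProjection x with hz
    have hAz : (A - A ∘L F.starProjection) x = A z := by simp [hz]
    have hzF : z ∈ Fᗮ := F.sub_starProjection_mem_orthogonal x
    have hzx : ‖z‖ ≤ ‖x‖ := by
      have h1 := F.norm_sq_eq_add_norm_sq_starProjection x
      rw [Submodule.starProjection_orthogonal_val] at h1
      rw [← hz] at h1
      have := sq_nonneg ‖F.starProjection x‖
      exact le_of_sq_le_sq (by linarith) (norm_nonneg _)
    rw [hAz] at hx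
    have hz0 : z ≠ 0 := by
      rintro h0
      rw [h0, map_zero, norm_zero] at hx
      exact absurd hx (not_lt.2 (by positivity))
    have hzpos : 0 < ‖z‖ := norm_pos_iff.2 hz0
    refine ⟨Matrix.vecCons ((‖z‖⁻¹ : ℂ) • z) e, orthonormal_vecCons_iff.2 ⟨?_, ?_, he⟩, ?_⟩
    · rw [norm_smul]; simp [hzpos.ne']
    · intro i
      rw [inner_smul_left, (F.mem_orthogonal' z).1 hzF _ (Submodule.subset_span ⟨i, rfl⟩), mul_zero]
    · intro i
      refine Fin.cases ?_ (fun j => ?_) i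
      · simp only [Matrix.cons_val_zero, map_smul, norm_smul, norm_inv, Complex.norm_real, norm_norm]
        rw [inv_mul_eq_div, lt_div_iff₀ hzpos]
        exact lt_of_le_of_lt (by gcongr) hx
      · simpa using hAe j

/-- Otherwise there are `N + 1` orthonormal vectors, each with image of squared norm above `M² / (N
+ 1)`. -/
theorem exists_rank_le_norm_sub_le (A : X →L[ℂ] Y) {M : ℝ} (hM : 0 ≤ M)
    (hA : ∀ (n : ℕ) (e : Fin n → X), Orthonormal ℂ e → ∑ i, ‖A (e i)‖ ^ 2 ≤ M ^ 2) (N : ℕ) :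
    ∃ R : X →L[ℂ] Y, (R : X →ₗ[ℂ] Y).rank ≤ (N : Cardinal) ∧ ‖A - R‖ ≤ M / √(N + 1) := by
  by_contra! h
  obtain ⟨e, he, hlt⟩ := exists_orthonormal_lt_norm_apply A h (by positivity) (N + 1) le_rfl
  have h1 := hA _ e he
  have h2 : ∑ _i : Fin (N + 1), (M / √(N + 1)) ^ 2 < ∑ i, ‖A (e i)‖ ^ 2 :=
    Finset.sum_lt_sum_of_nonempty Finset.univ_nonempty fun i _ =>
      pow_lt_pow_left₀ (hlt i) (by positivity) (by norm_num)
  have h3 : ∑ _i : Fin (N + 1), (M / √(N + 1)) ^ 2 = M ^ 2 := by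
    rw [Finset.sum_const, Finset.card_univ, Fintype.card_fin, nsmul_eq_mul, div_pow,
      Real.sq_sqrt (by positivity)]
    push_cast
    field_simp
  linarith

end FiniteRankApproximation

/-! ### Extending an inner-product-preserving family -/

section Extension

variable {ι X H : Type*} [NormedAddCommGroup X] [InnerProductSpace ℂ X]
  [NormedAddCommGroup H] [InnerProductSpace ℂ H] [CompleteSpace H]

/-- Equal Gram matrices give linear combinations of equal norm, so `a i ↦ b i` is well defined on
the span and extends by density. -/
theorem exists_contraction_of_inner_eq (a : ι → X) (b : ι → H)
    (hab : ∀ i j, inner ℂ (a i) (a j) = inner ℂ (b i) (b j))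
    (ha : Dense (Submodule.span ℂ (Set.range a) : Set X)) :
    ∃ V : X →L[ℂ] H, ‖V‖ ≤ 1 ∧ ∀ i, V (a i) = b i := by
  have hinner : ∀ x : ι →₀ ℂ, ‖Finsupp.linearCombination ℂ b x‖
      = ‖Finsupp.linearCombination ℂ a x‖ := by
    intro x
    rw [@norm_eq_sqrt_re_inner ℂ, @norm_eq_sqrt_re_inner ℂ]
    simp only [Finsupp.linearCombination_apply, Finsupp.sum, sum_inner, inner_sum, inner_smul_left,
      inner_smul_right, hab]
  have hdense : DenseRange (Finsupp.linearCombination ℂ a) := by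
    rw [DenseRange, ← LinearMap.coe_range, Finsupp.range_linearCombination]
    exact ha
  have hle : ∀ x : ι →₀ ℂ, ‖Finsupp.linearCombination ℂ b x‖
      ≤ 1 * ‖Finsupp.linearCombination ℂ a x‖ := fun x => by rw [hinner, one_mul]
  refine ⟨(Finsupp.linearCombination ℂ b).extendOfNorm (Finsupp.linearCombination ℂ a),
    LinearMap.opNorm_extendOfNorm_le hdense zero_le_one hle, fun i => ?_⟩
  have := LinearMap.extendOfNorm_eq hdense ⟨1, hle⟩ (Finsupp.single i 1)
  simpa using this

end Extension

/-! ### Integral operators with square-integrable kernels -/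

section KernelOperator

variable {α β : Type*} [MeasurableSpace α] [MeasurableSpace β] {μ : Measure α} {ν : Measure β}

theorem memLp_two_mul_prod {h : α → ℂ} {g : β → ℂ} (hh : MemLp h 2 μ) (hg : MemLp g 2 ν) :
    MemLp (fun p : α × β => h p.1 * g p.2) 2 (μ.prod ν) := by
  have hm : AEStronglyMeasurable (fun p : α × β => h p.1 * g p.2) (μ.prod ν) :=
    hh.1.comp_fst.mul hg.1.comp_snd
  rw [memLp_two_iff_integrable_sq_norm hm]
  simp only [norm_mul, mul_pow]
  exact ((memLp_two_iff_integrable_sq_norm hh.1).1 hh).mul_prod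
    ((memLp_two_iff_integrable_sq_norm hg.1).1 hg)

/-- The function `(x, y) ↦ h x * conj (g y)` in `L²(μ × ν)`. -/
noncomputable def tensorConj (h : Lp ℂ 2 μ) (g : Lp ℂ 2 ν) : Lp ℂ 2 (μ.prod ν) :=
  (memLp_two_mul_prod (Lp.memLp h) (Lp.memLp g).star).toLp _

theorem coeFn_tensorConj (h : Lp ℂ 2 μ) (g : Lp ℂ 2 ν) :
    tensorConj h g =ᵐ[μ.prod ν] fun p => h p.1 * star (g p.2) :=
  MemLp.coeFn_toLp _

theorem tensorConj_ae_of_ae {h : Lp ℂ 2 μ} {g : Lp ℂ 2 ν} {h' : α → ℂ} {g' : β → ℂ}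
    (hh : h =ᵐ[μ] h') (hg : g =ᵐ[ν] g') :
    tensorConj h g =ᵐ[μ.prod ν] fun p => h' p.1 * star (g' p.2) := by
  filter_upwards [coeFn_tensorConj h g, Measure.quasiMeasurePreserving_fst.ae hh,
    Measure.quasiMeasurePreserving_snd.ae hg] with p h1 h2 h3
  rw [h1, h2, h3]

theorem tensorConj_add_left (h h' : Lp ℂ 2 μ) (g : Lp ℂ 2 ν) :
    tensorConj (h + h') g = tensorConj h g + tensorConj h' g := by
  ext1
  filter_upwards [tensorConj_ae_of_ae (Lp.coeFn_add h h') (ae_eq_refl g), coeFn_tensorConj h g,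
    coeFn_tensorConj h' g, Lp.coeFn_add (tensorConj h g) (tensorConj h' g)] with p h1 h2 h3 h4
  rw [h1, h4, Pi.add_apply, Pi.add_apply, h2, h3, add_mul]

theorem tensorConj_add_right (h : Lp ℂ 2 μ) (g g' : Lp ℂ 2 ν) :
    tensorConj h (g + g') = tensorConj h g + tensorConj h g' := by
  ext1
  filter_upwards [tensorConj_ae_of_ae (ae_eq_refl h) (Lp.coeFn_add g g'), coeFn_tensorConj h g,
    coeFn_tensorConj h g', Lp.coeFn_add (tensorConj h g) (tensorConj h g')] with p h1 h2 h3 h4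
  rw [h1, h4, Pi.add_apply, Pi.add_apply, h2, h3, star_add, mul_add]

theorem tensorConj_smul_left (c : ℂ) (h : Lp ℂ 2 μ) (g : Lp ℂ 2 ν) :
    tensorConj (c • h) g = c • tensorConj h g := by
  ext1
  filter_upwards [tensorConj_ae_of_ae (Lp.coeFn_smul c h) (ae_eq_refl g), coeFn_tensorConj h g,
    Lp.coeFn_smul c (tensorConj h g)] with p h1 h2 h3
  rw [h1, h3, Pi.smul_apply, Pi.smul_apply, h2, smul_eq_mul, smul_eq_mul, mul_assoc]

theorem tensorConj_smul_right (c : ℂ) (h : Lp ℂ 2 μ) (g : Lp ℂ 2 ν) :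
    tensorConj h (c • g) = star c • tensorConj h g := by
  ext1
  filter_upwards [tensorConj_ae_of_ae (ae_eq_refl h) (Lp.coeFn_smul c g), coeFn_tensorConj h g,
    Lp.coeFn_smul (star c) (tensorConj h g)] with p h1 h2 h3
  rw [h1, h3, Pi.smul_apply, Pi.smul_apply, h2, smul_eq_mul, smul_eq_mul, star_mul']
  ring

variable [IsFiniteMeasure μ] [IsFiniteMeasure ν]

theorem inner_tensorConj (h h' : Lp ℂ 2 μ) (g g' : Lp ℂ 2 ν) :
    inner ℂ (tensorConj h g) (tensorConj h' g') = inner ℂ h h' * inner ℂ g' g := by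
  rw [L2.inner_def, L2.inner_def, L2.inner_def, ← integral_prod_mul]
  refine integral_congr_ae ?_
  filter_upwards [coeFn_tensorConj h g, coeFn_tensorConj h' g'] with p h1 h2
  rw [h1, h2]
  simp only [RCLike.inner_apply, map_mul, RCLike.star_def, Complex.conj_conj]
  ring

theorem norm_tensorConj (h : Lp ℂ 2 μ) (g : Lp ℂ 2 ν) : ‖tensorConj h g‖ = ‖h‖ * ‖g‖ := by
  have h1 := inner_tensorConj h h g g
  rw [inner_self_eq_norm_sq_to_K, inner_self_eq_norm_sq_to_K, inner_self_eq_norm_sq_to_K,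
    ← mul_pow] at h1
  have h2 : ‖tensorConj h g‖ ^ 2 = (‖h‖ * ‖g‖) ^ 2 := by exact_mod_cast h1
  exact (pow_left_inj₀ (norm_nonneg _) (by positivity) two_ne_zero).1 h2

/-- Riesz representation of the bounded sesquilinear form on the right; conjugating `g` in the
tensor makes it linear in `g`. -/
theorem exists_kernelOp (Φ : Lp ℂ 2 (μ.prod ν)) :
    ∃ K : Lp ℂ 2 ν →L[ℂ] Lp ℂ 2 μ, ∀ g h, inner ℂ h (K g) = inner ℂ (tensorConj h g) Φ := by
  let ℓ : Lp ℂ 2 ν → StrongDual ℂ (Lp ℂ 2 μ) := fun g =>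
    LinearMap.mkContinuous
      { toFun := fun h => inner ℂ Φ (tensorConj h g)
        map_add' := fun h h' => by rw [tensorConj_add_left, inner_add_right]
        map_smul' := fun c h => by rw [tensorConj_smul_left, inner_smul_right]; rfl }
      (‖Φ‖ * ‖g‖) fun h => by
        refine (norm_inner_le_norm (𝕜 := ℂ) Φ (tensorConj h g)).trans_eq ?_
        rw [norm_tensorConj]; ring
  have hℓ : ∀ g h, ℓ g h = inner ℂ Φ (tensorConj h g) := fun g h => rfl
  have key : ∀ (g : Lp ℂ 2 ν) (h : Lp ℂ 2 μ), inner ℂ h ((InnerProductSpace.toDual ℂ (Lp ℂ 2 μ)).symm (ℓ g))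
      = inner ℂ (tensorConj h g) Φ := by
    intro g h
    rw [← inner_conj_symm, InnerProductSpace.toDual_symm_apply, hℓ, inner_conj_symm]
  refine ⟨LinearMap.mkContinuous
    { toFun := fun g => (InnerProductSpace.toDual ℂ (Lp ℂ 2 μ)).symm (ℓ g)
      map_add' := fun g g' => ext_inner_left ℂ fun h => by
        rw [inner_add_right, key, key, key, tensorConj_add_right, inner_add_left]
      map_smul' := fun c g => ext_inner_left ℂ fun h => by
        rw [inner_smul_right, key, key, tensorConj_smul_right, inner_smul_left]; simp }
    ‖Φ‖ fun g => ?_, fun g h => key g h⟩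
  simp only [LinearMap.coe_mk, AddHom.coe_mk, LinearIsometryEquiv.norm_map]
  exact LinearMap.mkContinuous_norm_le _ (by positivity) _

/-- The integral operator `L²(ν) → L²(μ)` with kernel `Φ ∈ L²(μ × ν)`. -/
noncomputable def kernelOp (Φ : Lp ℂ 2 (μ.prod ν)) : Lp ℂ 2 ν →L[ℂ] Lp ℂ 2 μ :=
  (exists_kernelOp Φ).choose

theorem inner_kernelOp (Φ : Lp ℂ 2 (μ.prod ν)) (g : Lp ℂ 2 ν) (h : Lp ℂ 2 μ) :
    inner ℂ h (kernelOp Φ g) = inner ℂ (tensorConj h g) Φ :=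
  (exists_kernelOp Φ).choose_spec g h

theorem kernelOp_add (Φ Ψ : Lp ℂ 2 (μ.prod ν)) : kernelOp (Φ + Ψ) = kernelOp Φ + kernelOp Ψ := by
  ext1 g
  refine ext_inner_left ℂ fun h => ?_
  simp only [add_apply, inner_add_right, inner_kernelOp]

theorem kernelOp_zero : kernelOp (0 : Lp ℂ 2 (μ.prod ν)) = 0 := by
  ext1 g
  refine ext_inner_left ℂ fun h => ?_
  simp [inner_kernelOp]

theorem kernelOp_sum {ι : Type*} (s : Finset ι) (Φ : ι → Lp ℂ 2 (μ.prod ν)) :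
    kernelOp (∑ i ∈ s, Φ i) = ∑ i ∈ s, kernelOp (Φ i) := by
  classical
  induction s using Finset.induction_on with
  | empty => simp [kernelOp_zero]
  | insert i s hi ih => rw [Finset.sum_insert hi, Finset.sum_insert hi, kernelOp_add, ih]

theorem rank_kernelOp_tensorConj_le (a : Lp ℂ 2 μ) (b : Lp ℂ 2 ν) :
    (kernelOp (tensorConj a b) : Lp ℂ 2 ν →ₗ[ℂ] Lp ℂ 2 μ).rank ≤ 1 := by
  have h : (kernelOp (tensorConj a b) : Lp ℂ 2 ν →ₗ[ℂ] Lp ℂ 2 μ)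
      = (LinearMap.toSpanSingleton ℂ _ a) ∘ₗ (innerSL ℂ b : Lp ℂ 2 ν →ₗ[ℂ] ℂ) := by
    ext1 g
    refine ext_inner_left ℂ fun h => ?_
    simp only [ContinuousLinearMap.coe_coe, inner_kernelOp, inner_tensorConj, LinearMap.comp_apply,
      LinearMap.toSpanSingleton_apply, inner_smul_right, innerSL_apply_apply]
    ring
  rw [h]
  refine (rank_comp_le_finrank _ _).trans ?_
  simp

/-- Bessel's inequality for `Φ` against the tensors `w i ⊗ conj (e i)`, with `w i` the normalised
image of `e i`. Orthogonality of the `e i` alone makes the tensors orthogonal. -/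
theorem sum_norm_sq_kernelOp_le (Φ : Lp ℂ 2 (μ.prod ν)) {n : ℕ} {e : Fin n → Lp ℂ 2 ν}
    (he : Orthonormal ℂ e) : ∑ i, ‖kernelOp Φ (e i)‖ ^ 2 ≤ ‖Φ‖ ^ 2 := by
  classical
  -- Vanishing images cannot be normalised and contribute nothing.
  set s : Finset (Fin n) := Finset.univ.filter fun i => kernelOp Φ (e i) ≠ 0 with hs
  let w : Fin n → Lp ℂ 2 μ := fun i => (‖kernelOp Φ (e i)‖⁻¹ : ℂ) • kernelOp Φ (e i)
  have hw : ∀ i ∈ s, ‖w i‖ = 1 := by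
    intro i hi
    have : ‖kernelOp Φ (e i)‖ ≠ 0 := norm_ne_zero_iff.2 (Finset.mem_filter.1 hi).2
    simp [w, norm_smul, this]
  have horth : Orthonormal ℂ fun i : s => tensorConj (w i) (e i) := by
    refine ⟨fun i => ?_, fun i j hij => ?_⟩
    · rw [norm_tensorConj, hw i i.2, he.1, one_mul]
    · simp only [inner_tensorConj]
      rw [he.2 (fun h => hij (Subtype.ext h.symm)), mul_zero]
  have hinner : ∀ i, ‖kernelOp Φ (e i)‖ = ‖inner ℂ (tensorConj (w i) (e i)) Φ‖ := by
    intro i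
    rw [← inner_kernelOp]
    simp only [w, inner_smul_left, inner_self_eq_norm_sq_to_K, norm_mul, RCLike.norm_conj, norm_inv,
      norm_pow]
    by_cases h0 : ‖kernelOp Φ (e i)‖ = 0
    · simp [h0]
    · simp; field_simp
  calc ∑ i, ‖kernelOp Φ (e i)‖ ^ 2 = ∑ i ∈ s, ‖kernelOp Φ (e i)‖ ^ 2 := by
        refine (Finset.sum_subset (Finset.subset_univ _) fun i _ hi => ?_).symm
        have : kernelOp Φ (e i) = 0 := by simpa [hs] using hi
        simp [this]
    _ = ∑ i ∈ (Finset.univ : Finset s), ‖inner ℂ (tensorConj (w i) (e i)) Φ‖ ^ 2 := by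
        rw [← Finset.sum_coe_sort]
        exact Finset.sum_congr rfl fun i _ => by rw [hinner]
    _ ≤ ‖Φ‖ ^ 2 := horth.sum_inner_products_le Φ

/-- A kernel within `L²`-distance `ε` of a sum of `card s` product kernels defines an operator
within `ε / √(N + 1)` of the operators of rank at most `card s + N`. -/
theorem exists_rank_le_norm_kernelOp_sub_le (Φ : Lp ℂ 2 (μ.prod ν)) {ι : Type*} (s : Finset ι)
    (a : ι → Lp ℂ 2 μ) (b : ι → Lp ℂ 2 ν) (N : ℕ) :
    ∃ R : Lp ℂ 2 ν →L[ℂ] Lp ℂ 2 μ,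
      (R : Lp ℂ 2 ν →ₗ[ℂ] Lp ℂ 2 μ).rank ≤ ((s.card + N : ℕ) : Cardinal) ∧
      ‖kernelOp Φ - R‖ ≤ ‖Φ - ∑ i ∈ s, tensorConj (a i) (b i)‖ / √(N + 1) := by
  classical
  obtain ⟨R, hR, hle⟩ := exists_rank_le_norm_sub_le
    (kernelOp (Φ - ∑ i ∈ s, tensorConj (a i) (b i))) (norm_nonneg _)
    (fun n e he => sum_norm_sq_kernelOp_le _ he) N
  refine ⟨∑ i ∈ s, kernelOp (tensorConj (a i) (b i)) + R, ?_, ?_⟩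
  · rw [ContinuousLinearMap.toLinearMap_add]
    refine (LinearMap.rank_add_le _ _).trans ?_
    push_cast
    refine add_le_add ?_ hR
    refine (LinearMap.rank_finsetSum_le _ _).trans ?_
    refine (Finset.sum_le_card_nsmul _ _ 1 fun i _ => rank_kernelOp_tensorConj_le _ _).trans ?_
    simp
  · have h : kernelOp Φ - (∑ i ∈ s, kernelOp (tensorConj (a i) (b i)) + R)
        = kernelOp (Φ - ∑ i ∈ s, tensorConj (a i) (b i)) - R := by
      rw [← sub_sub, ← kernelOp_sum, sub_left_inj, sub_eq_iff_eq_add, ← kernelOp_add,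
        sub_add_cancel]
    rw [h]
    exact hle

theorem norm_kernelOp_le (Φ : Lp ℂ 2 (μ.prod ν)) : ‖kernelOp Φ‖ ≤ ‖Φ‖ := by
  refine ContinuousLinearMap.opNorm_le_bound _ (norm_nonneg _) fun g => ?_
  have h := inner_kernelOp Φ g (kernelOp Φ g)
  rw [inner_self_eq_norm_sq_to_K] at h
  have h2 : ‖kernelOp Φ g‖ ^ 2 ≤ (‖kernelOp Φ g‖ * ‖g‖) * ‖Φ‖ := by
    rw [← norm_tensorConj]
    refine le_trans (le_of_eq ?_) (norm_inner_le_norm (𝕜 := ℂ) _ _)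
    rw [← h]; simp
  rcases (norm_nonneg (kernelOp Φ g)).eq_or_lt with h0 | h0
  · rw [← h0]; positivity
  · nlinarith

end KernelOperator

/-! ### Estimates for the divided difference -/

section DividedDifference

variable {f : ℝ → ℂ} {L : ℝ≥0}

theorem norm_dividedDifference_le (hf : LipschitzWith L f) (p : ℝ × ℝ) :
    ‖dividedDifference f p‖ ≤ L := by
  unfold dividedDifference
  split_ifs with h
  · simp
  · rw [norm_div, ← Complex.ofReal_sub, Complex.norm_real]
    exact div_le_of_le_mul₀ (norm_nonneg _) L.2 (by simpa [dist_eq_norm] using hf.dist_le_mul p.1 p.2)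

theorem dividedDifference_swap (x y : ℝ) :
    dividedDifference f (x, y) = dividedDifference f (y, x) := by
  simp only [dividedDifference, eq_comm (a := x)]
  split_ifs with h
  · rfl
  · rw [← neg_sub (f y), ← neg_sub (y : ℂ), neg_div_neg_eq]

theorem measurable_dividedDifference (hf : LipschitzWith L f) :
    Measurable (dividedDifference f) := by
  have hm := hf.continuous.measurable
  refine Measurable.ite (measurableSet_eq_fun measurable_fst measurable_snd) measurable_const ?_
  fun_prop

/-- Off the diagonal, with `D` the divided difference, `(D(x,y) - D(c,y)) (x - y) = (f x - f c) -
D(c,y) (x - c)`. The value `0` on the diagonal is harmless: for `c = y` only `D(x,y)` remains. -/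
theorem norm_dividedDifference_sub_mul_le (hf : LipschitzWith L f) (x c y : ℝ) :
    ‖dividedDifference f (x, y) - dividedDifference f (c, y)‖ * |x - y| ≤ 2 * L * |x - c| := by
  by_cases hxy : x = y
  · simp only [hxy, sub_self, abs_zero, mul_zero]; positivity
  have hL := norm_dividedDifference_le hf
  by_cases hcy : c = y
  · have h0 : dividedDifference f (c, y) = 0 := by simp [dividedDifference, hcy]
    rw [h0, sub_zero, hcy]
    have := hL (x, y)
    have h2 : 0 ≤ (L : ℝ) * |x - y| := by positivity
    nlinarith [abs_nonneg (x - y)]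
  have hxy' : (x : ℂ) - y ≠ 0 := by
    rw [← Complex.ofReal_sub]; exact_mod_cast sub_ne_zero.2 hxy
  have hcy' : (c : ℂ) - y ≠ 0 := by
    rw [← Complex.ofReal_sub]; exact_mod_cast sub_ne_zero.2 hcy
  have key : (dividedDifference f (x, y) - dividedDifference f (c, y)) * ((x - y : ℝ) : ℂ)
      = (f x - f c) - dividedDifference f (c, y) * ((x - c : ℝ) : ℂ) := by
    simp only [dividedDifference, if_neg hxy, if_neg hcy]
    push_cast
    field_simp
    ring
  rw [← Real.norm_eq_abs, ← Complex.norm_real, ← norm_mul, key]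
  refine (norm_sub_le _ _).trans ?_
  rw [norm_mul, Complex.norm_real, Real.norm_eq_abs]
  have h1 : ‖f x - f c‖ ≤ L * |x - c| := by simpa [dist_eq_norm] using hf.dist_le_mul x c
  have h2 := mul_le_mul_of_nonneg_right (hL (c, y)) (abs_nonneg (x - c))
  linarith

/-- Adding the trivial bound `2L`, multiplied by `d`, to the previous estimate controls the
difference times `|x - y| + d`. This covers nearby points as well, with no singularity at `x = y`.
-/
theorem norm_dividedDifference_sub_sq_le (hf : LipschitzWith L f) {x c y d s : ℝ}
    (hxc : |x - c| ≤ d) (hd : 0 < d) (hs : 0 < s) (hsd : s ≤ |x - y| + d) :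
    ‖dividedDifference f (x, y) - dividedDifference f (c, y)‖ ^ 2 ≤ 16 * L ^ 2 * (d / s) ^ 2 := by
  have h1 := norm_dividedDifference_sub_mul_le hf x c y
  have h2 : ‖dividedDifference f (x, y) - dividedDifference f (c, y)‖ ≤ 2 * L :=
    (norm_sub_le _ _).trans (by
      linarith [norm_dividedDifference_le hf (x, y), norm_dividedDifference_le hf (c, y)])
  have hL := L.2
  have h3 : ‖dividedDifference f (x, y) - dividedDifference f (c, y)‖ ≤ 4 * L * (d / s) := by
    rw [← mul_div_assoc, le_div_iff₀ hs]
    have a1 := mul_le_mul_of_nonneg_left hsd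
      (norm_nonneg (dividedDifference f (x, y) - dividedDifference f (c, y)))
    have a2 := mul_le_mul_of_nonneg_right h2 hd.le
    have a3 : 2 * (L : ℝ) * |x - c| ≤ 2 * L * d := by gcongr
    linarith
  calc _ ≤ (4 * L * (d / s)) ^ 2 := by gcongr
    _ = _ := by ring

end DividedDifference

/-! ### Partitions of the line into pieces of small mass -/

section Quantiles

open ProbabilityTheory Filter Topology

theorem exists_quantile (σ : Measure ℝ) [IsProbabilityMeasure σ] {a : ℝ} (h0 : 0 < a)
    (h1 : a < 1) : ∃ q, a ≤ cdf σ q ∧ ∀ x < q, cdf σ x < a := by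
  set S := {x | a ≤ cdf σ x} with hS
  obtain ⟨x1, hx1⟩ := ((tendsto_cdf_atTop σ).eventually (eventually_gt_nhds h1)).exists
  obtain ⟨x0, hx0⟩ := ((tendsto_cdf_atBot σ).eventually (eventually_lt_nhds h0)).exists
  have hne : S.Nonempty := ⟨x1, hx1.le⟩
  have hbdd : BddBelow S := ⟨x0, fun y hy => by
    by_contra! h
    exact absurd (hy.trans (monotone_cdf σ h.le)) (not_le.2 hx0)⟩
  refine ⟨sInf S, ?_, fun x hx => ?_⟩
  · have hlim : Tendsto (cdf σ) (𝓝[>] (sInf S)) (𝓝 (cdf σ (sInf S))) :=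
      ((cdf σ).right_continuous (sInf S)).mono_left (nhdsWithin_mono _ Set.Ioi_subset_Ici_self)
    refine ge_of_tendsto hlim ?_
    filter_upwards [self_mem_nhdsWithin] with y hy
    obtain ⟨z, hz, hzy⟩ := exists_lt_of_csInf_lt hne hy
    exact le_trans hz (monotone_cdf σ hzy.le)
  · by_contra! h
    exact absurd (csInf_le hbdd h) (not_le.2 hx)

theorem leftLim_cdf_le (σ : Measure ℝ) {a q : ℝ} (hq : ∀ x < q, cdf σ x < a) :
    Function.leftLim (cdf σ) q ≤ a := by
  refine le_of_tendsto ((monotone_cdf σ).tendsto_leftLim q) ?_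
  filter_upwards [self_mem_nhdsWithin] with x hx using (hq x hx).le

/-- The breakpoints are quantiles at levels spaced by `1 / (N + 1)`. Intervals must be open: a
breakpoint may be an atom of large mass. -/
theorem exists_partition (σ : Measure ℝ) [IsProbabilityMeasure σ] {N : ℕ} (hN : 1 ≤ N) :
    ∃ t : ℕ → ℝ, Monotone t ∧ (∀ i, σ.real (Set.Ioo (t i) (t (i + 1))) ≤ 1 / N) ∧
      σ.real (Set.Iio (t 0)) ≤ 1 / N ∧ σ.real (Set.Ioi (t N)) ≤ 1 / N := by
  have hN0 : (0 : ℝ) < N := by exact_mod_cast hN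
  -- The cap at `N` keeps every level strictly below `1`, where quantiles exist; the levels `a (N -
  -- 1)` and `a N` coincide.
  let a : ℕ → ℝ := fun i => (min (i + 1) N : ℕ) / (N + 1 : ℝ)
  have ha0 : ∀ i, 0 < a i := fun i => by
    have : 0 < min (i + 1) N := by omega
    simp only [a]; positivity
  have ha1 : ∀ i, a i < 1 := fun i => by
    simp only [a]
    rw [div_lt_one (by positivity)]
    have : min (i + 1) N < N + 1 := by omega
    exact_mod_cast this
  have hmono : Monotone a := fun i j hij => by
    simp only [a]
    have : min (i + 1) N ≤ min (j + 1) N := by omega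
    gcongr
  have hstep : 1 / (N + 1 : ℝ) ≤ 1 / N := by gcongr; linarith
  choose t ht1 ht2 using fun i => exists_quantile σ (ha0 i) (ha1 i)
  refine ⟨t, fun i j hij => ?_, fun i => ?_, ?_, ?_⟩
  · by_contra! h
    exact absurd ((hmono hij).trans (ht1 j)) (not_le.2 (ht2 i _ h))
  · rw [measureReal_def, ← measure_cdf σ, StieltjesFunction.measure_Ioo, ENNReal.toReal_ofReal']
    refine (max_le ?_ (by positivity)).trans hstep
    have h3 : a (i + 1) - a i ≤ 1 / (N + 1) := by
      simp only [a]
      rw [← sub_div]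
      gcongr
      rw [sub_le_iff_le_add]
      have : min (i + 1 + 1) N ≤ 1 + min (i + 1) N := by omega
      exact_mod_cast this
    linarith [leftLim_cdf_le σ (ht2 (i + 1)), ht1 i]
  · rw [measureReal_def, ← measure_cdf σ, StieltjesFunction.measure_Iio _ (tendsto_cdf_atBot σ),
      ENNReal.toReal_ofReal']
    refine (max_le ?_ (by positivity)).trans hstep
    have h3 : a 0 ≤ 1 / (N + 1) := by simp [a, hN]
    linarith [leftLim_cdf_le σ (ht2 0)]
  · rw [measureReal_def, ← measure_cdf σ, StieltjesFunction.measure_Ioi _ (tendsto_cdf_atTop σ),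
      ENNReal.toReal_ofReal']
    refine (max_le ?_ (by positivity)).trans hstep
    have h3 : 1 - a N = 1 / (N + 1) := by
      simp only [a]
      rw [min_eq_right (by omega)]
      field_simp
      ring
    linarith [ht1 N]

/-- Partition for the average `(μ + ν) / 2`, which dominates half of each measure. -/
theorem exists_partition_pair (μ ν : Measure ℝ) [IsProbabilityMeasure μ] [IsProbabilityMeasure ν]
    {N : ℕ} (hN : 1 ≤ N) :
    ∃ t : ℕ → ℝ, Monotone t ∧ ∀ ρ ∈ ({μ, ν} : Set (Measure ℝ)),
      (∀ i, ρ.real (Set.Ioo (t i) (t (i + 1))) ≤ 2 / N) ∧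
      ρ.real (Set.Iio (t 0)) ≤ 2 / N ∧ ρ.real (Set.Ioi (t N)) ≤ 2 / N := by
  let σ : Measure ℝ := (2⁻¹ : ℝ≥0∞) • (μ + ν)
  have hσ : IsProbabilityMeasure σ := ⟨by
    simp only [σ, Measure.smul_apply, Measure.add_apply, measure_univ, smul_eq_mul]
    rw [one_add_one_eq_two]
    exact ENNReal.inv_mul_cancel (by simp) (by simp)⟩
  obtain ⟨t, ht, h1, h2, h3⟩ := exists_partition σ hN
  have hreal : ∀ S, σ.real S = (μ.real S + ν.real S) / 2 := fun S => by
    rw [measureReal_ennreal_smul_apply, measureReal_add_apply]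
    simp
    ring
  have hle : ∀ ρ ∈ ({μ, ν} : Set (Measure ℝ)), ∀ S, σ.real S ≤ 1 / N → ρ.real S ≤ 2 / N := by
    intro ρ hρ S hS
    have h4 : (2 : ℝ) / N = 2 * (1 / N) := by ring
    rw [hreal] at hS
    have := measureReal_nonneg (μ := μ) (s := S)
    have := measureReal_nonneg (μ := ν) (s := S)
    rcases hρ with rfl | rfl <;> linarith
  exact ⟨t, ht, fun ρ hρ => ⟨fun i => hle ρ hρ _ (h1 i), hle ρ hρ _ h2, hle ρ hρ _ h3⟩⟩

end Quantiles

/-! ### Summability of the squared length ratios -/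

section Weights

/-- For the intervals `J i = (t i, t (i + 1))`, a bound for the squared ratio of the length of `J j`
to the distance between the far ends, provided that `J k` is not shorter than `J j`. -/
noncomputable def intervalWeight (t : ℕ → ℝ) (j k : ℕ) : ℝ :=
  if t (k + 1) - t k < t (j + 1) - t j then 0
  else if k = j then 1
  else if j < k then ((t (j + 1) - t j) / (t k - t j)) ^ 2
  else ((t (j + 1) - t j) / (t (j + 1) - t (k + 1))) ^ 2

theorem intervalWeight_nonneg (t : ℕ → ℝ) (j k : ℕ) : 0 ≤ intervalWeight t j k := by
  unfold intervalWeight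
  split_ifs <;> positivity

/-- The right side is `2de / (s (s + e))`, and `d (s + e) ≤ 2se`. With `e` the length of the next
interval, the bounds telescope. -/
theorem sq_div_le_sub {d s e : ℝ} (hd : 0 < d) (hs : d ≤ s) (he : d ≤ e) :
    (d / s) ^ 2 ≤ 2 * d / s - 2 * d / (s + e) := by
  have hs0 : 0 < s := hd.trans_le hs
  have he0 : 0 < e := hd.trans_le he
  rw [div_sub_div _ _ hs0.ne' (by positivity), div_pow, div_le_div_iff₀ (by positivity) (by positivity)]
  have : d * (s + e) ≤ 2 * s * e := by nlinarith
  nlinarith [mul_le_mul_of_nonneg_left this (by positivity : 0 ≤ d * s ^ 2)]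

/-- The diagonal term gives `1`, and on each side the telescoping sum is at most `2d / d = 2`.
Skipped shorter intervals only help, since the telescoping sequences are monotone. -/
theorem sum_intervalWeight_le {t : ℕ → ℝ} (ht : Monotone t) (j N : ℕ) :
    ∑ k ∈ Finset.range N, intervalWeight t j k ≤ 5 := by
  have hone : ∑ k ∈ Finset.range N, (if k = j then (1 : ℝ) else 0) ≤ 1 := by
    rw [Finset.sum_ite_eq']
    split_ifs <;> norm_num
  rcases (ht j.le_succ).eq_or_lt with hj | hj
  · refine (Finset.sum_le_sum fun k _ => ?_).trans (hone.trans (by norm_num))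
    simp only [Nat.succ_eq_add_one] at hj
    unfold intervalWeight
    split_ifs <;> simp [hj]
  rw [Nat.succ_eq_add_one] at hj
  set d := t (j + 1) - t j with hd
  have hd0 : 0 < d := sub_pos.2 hj
  -- The `max` and `min` make `u` constant up to `j + 1` and `w` constant from `j` on, so each
  -- sequence sees one side only and its denominators stay at least `d`.
  let u : ℕ → ℝ := fun k => 2 * d / (t (max k (j + 1)) - t j)
  let w : ℕ → ℝ := fun k => 2 * d / (t (j + 1) - t (min k j))
  have hu : ∀ k, u (k + 1) ≤ u k := fun k => by
    have h1 : t (j + 1) ≤ t (max k (j + 1)) := ht (le_max_right _ _)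
    have h2 : t (max k (j + 1)) ≤ t (max (k + 1) (j + 1)) := ht (by omega)
    simp only [u]
    gcongr
    linarith
  have hw : ∀ k, w k ≤ w (k + 1) := fun k => by
    have h1 : t (min (k + 1) j) ≤ t j := ht (min_le_right _ _)
    have h2 : t (min k j) ≤ t (min (k + 1) j) := ht (by omega)
    simp only [w]
    gcongr
    linarith
  have hterm : ∀ k, intervalWeight t j k
      ≤ (if k = j then 1 else 0) + (u k - u (k + 1)) + (w (k + 1) - w k) := by
    intro k
    have hu' := hu k
    have hw' := hw k
    unfold intervalWeight
    split_ifs with h1 h2 h3 h2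
    · linarith
    · linarith
    · linarith
    · have h4 : (d / (t k - t j)) ^ 2 ≤ u k - u (k + 1) := by
        have h5 := sq_div_le_sub (s := t k - t j) (e := t (k + 1) - t k) hd0
          (by have := ht (show j + 1 ≤ k by omega); linarith) (by linarith)
        simp only [u]
        rw [max_eq_left (by omega), max_eq_left (by omega)]
        convert h5 using 3
        ring
      linarith
    · have h4 : (d / (t (j + 1) - t (k + 1))) ^ 2 ≤ w (k + 1) - w k := by
        have h5 := sq_div_le_sub (s := t (j + 1) - t (k + 1)) (e := t (k + 1) - t k) hd0
          (by have := ht (show k + 1 ≤ j by omega); linarith) (by linarith)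
        simp only [w]
        rw [min_eq_left (by omega), min_eq_left (by omega)]
        convert h5 using 3
        ring
      linarith
  have hu0 : u 0 = 2 := by
    simp only [u]
    rw [max_eq_right (by omega), ← hd]
    field_simp
  have huN : 0 ≤ u N := by
    have : t (j + 1) ≤ t (max N (j + 1)) := ht (le_max_right _ _)
    exact div_nonneg (by linarith) (by linarith)
  have hw0 : 0 ≤ w 0 := by
    have : t (min 0 j) ≤ t j := ht (min_le_right _ _)
    exact div_nonneg (by linarith) (by linarith)
  have hwN : w N ≤ 2 := by
    have : t (min N j) ≤ t j := ht (min_le_right _ _)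
    exact div_le_of_le_mul₀ (by linarith) zero_le_two (by linarith)
  refine (Finset.sum_le_sum fun k _ => hterm k).trans ?_
  rw [Finset.sum_add_distrib, Finset.sum_add_distrib, Finset.sum_range_sub, Finset.sum_range_sub']
  linarith

end Weights

/-! ### Approximating the divided difference by sums of products -/

section ProductApproximation

variable {f : ℝ → ℂ} {L : ℝ≥0} {t : ℕ → ℝ}

theorem eq_of_mem_Ioo_of_mem_Ioo (ht : Monotone t) {x : ℝ} {j k : ℕ}
    (hj : x ∈ Set.Ioo (t j) (t (j + 1))) (hk : x ∈ Set.Ioo (t k) (t (k + 1))) : j = k := by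
  rcases lt_trichotomy j k with h | h | h
  · have := ht (show j + 1 ≤ k from h)
    linarith [hj.2, hk.1]
  · exact h
  · have := ht (show k + 1 ≤ j from h)
    linarith [hj.1, hk.2]

theorem notMem_Ioo_of_monotone (ht : Monotone t) (i j : ℕ) : t i ∉ Set.Ioo (t j) (t (j + 1)) := by
  rintro ⟨h1, h2⟩
  have h3 : j < i := ht.reflect_lt h1
  have h4 : i < j + 1 := ht.reflect_lt h2
  omega

theorem mem_cover {N : ℕ} {x : ℝ} (h0 : ¬ x < t 0) (hN : ¬ t N < x)
    (hP : x ∉ (Finset.range (N + 1)).image t) :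
    ∃ j ∈ Finset.range N, x ∈ Set.Ioo (t j) (t (j + 1)) := by
  have hne : ∀ i ≤ N, t i ≠ x := fun i hi h =>
    hP (Finset.mem_image.2 ⟨i, Finset.mem_range.2 (by omega), h⟩)
  have h0' : t 0 < x := lt_of_le_of_ne (not_lt.1 h0) (hne 0 (by omega))
  have hN' : x < t N := lt_of_le_of_ne (not_lt.1 hN) (hne N le_rfl).symm
  by_contra! h
  have : ∀ i ≤ N, t i < x := by
    intro i hi
    induction i with
    | zero => exact h0'
    | succ i ih =>
      have h1 := ih (by omega)
      refine lt_of_le_of_ne ?_ (hne (i + 1) hi)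
      by_contra! h2
      exact h i (Finset.mem_range.2 (by omega)) ⟨h1, h2⟩
  exact absurd (this N le_rfl) (not_lt.2 hN'.le)

/-- Adding the length of `J j` to `|x - y|` gives at least the distance from the far end of `J j` to
the near end of `J k`, the denominator in the weight. -/
theorem norm_sub_sq_le_intervalWeight (hf : LipschitzWith L f) (ht : Monotone t) {x y : ℝ}
    {j k : ℕ} (hx : x ∈ Set.Ioo (t j) (t (j + 1))) (hy : y ∈ Set.Ioo (t k) (t (k + 1)))
    (hjk : ¬ t (k + 1) - t k < t (j + 1) - t j) :
    ‖dividedDifference f (x, y) - dividedDifference f (t j, y)‖ ^ 2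
      ≤ 16 * L ^ 2 * intervalWeight t j k := by
  have hd : 0 < t (j + 1) - t j := by linarith [hx.1, hx.2]
  have hxc : |x - t j| ≤ t (j + 1) - t j := by
    rw [abs_of_pos (sub_pos.2 hx.1)]; linarith [hx.2]
  unfold intervalWeight
  rw [if_neg hjk]
  split_ifs with h1 h2
  · have := norm_dividedDifference_sub_sq_le hf (y := y) hxc hd hd (by linarith [abs_nonneg (x - y)])
    rwa [div_self hd.ne', one_pow] at this
  · have h3 : t (j + 1) ≤ t k := ht h2
    refine norm_dividedDifference_sub_sq_le hf hxc hd (by linarith) ?_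
    rw [abs_sub_comm, abs_of_pos (by linarith [hx.2, hy.1])]
    linarith [hx.2, hy.1]
  · have h3 : t (k + 1) ≤ t j := ht (by omega)
    refine norm_dividedDifference_sub_sq_le hf hxc hd (by linarith) ?_
    rw [abs_of_pos (by linarith [hx.1, hy.2])]
    linarith [hx.1, hy.2]

/-- The index set of the approximating sum: the first two summands run over exceptional points, the
last two over intervals. -/
abbrev ApproxIndex := (ℝ ⊕ ℝ) ⊕ (ℕ ⊕ ℕ)

/-- The indices used for the approximation with `N` intervals. -/
noncomputable def approxIndices (t : ℕ → ℝ) (N : ℕ) : Finset ApproxIndex :=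
  (((Finset.range (N + 1)).image t).disjSum ((Finset.range (N + 1)).image t)).disjSum
    ((Finset.range N).disjSum (Finset.range N))

/-- The union of those intervals that are not shorter than the `j`-th one. -/
def longIntervals (t : ℕ → ℝ) (N j : ℕ) : Set ℝ :=
  ⋃ k ∈ {k ∈ Finset.range N | ¬ t (k + 1) - t k < t (j + 1) - t j}, Set.Ioo (t k) (t (k + 1))

/-- The union of those intervals that are longer than the `k`-th one. -/
def shortIntervals (t : ℕ → ℝ) (N k : ℕ) : Set ℝ :=
  ⋃ j ∈ {j ∈ Finset.range N | t (k + 1) - t k < t (j + 1) - t j}, Set.Ioo (t j) (t (j + 1))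

/-- The factors depending on `x` of the approximating sum. -/
noncomputable def approxLeft (f : ℝ → ℂ) (t : ℕ → ℝ) (N : ℕ) : ApproxIndex → ℝ → ℂ :=
  Sum.elim
    (Sum.elim (fun p => Set.indicator {p} 1)
      (fun p => Set.indicator (((Finset.range (N + 1)).image t : Set ℝ)ᶜ)
        fun x => dividedDifference f (x, p)))
    (Sum.elim (fun j => Set.indicator (Set.Ioo (t j) (t (j + 1))) 1)
      (fun k => Set.indicator (shortIntervals t N k) fun x => dividedDifference f (x, t k)))

/-- The factors depending on `y` of the approximating sum. -/
noncomputable def approxRight (f : ℝ → ℂ) (t : ℕ → ℝ) (N : ℕ) : ApproxIndex → ℝ → ℂ :=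
  Sum.elim
    (Sum.elim (fun p y => dividedDifference f (p, y)) (fun p => Set.indicator {p} 1))
    (Sum.elim
      (fun j => Set.indicator (longIntervals t N j) fun y => dividedDifference f (t j, y))
      (fun k => Set.indicator (Set.Ioo (t k) (t (k + 1))) 1))

theorem card_approxIndices_le (t : ℕ → ℝ) {N : ℕ} (hN : 1 ≤ N) :
    (approxIndices t N).card ≤ 6 * N := by
  have h := Finset.card_image_le (s := Finset.range (N + 1)) (f := t)
  simp only [approxIndices, Finset.card_disjSum, Finset.card_range] at h ⊢
  omega

theorem norm_indicator_le_of_forall_le {s : Set ℝ} {φ : ℝ → ℂ} {C : ℝ}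
    (h : ∀ x, ‖φ x‖ ≤ C) (x : ℝ) : ‖s.indicator φ x‖ ≤ C :=
  (norm_indicator_le_norm_self _ _).trans (h x)

theorem approxLeft_spec (hf : LipschitzWith L f) (t : ℕ → ℝ) (N : ℕ) (i : ApproxIndex) :
    Measurable (approxLeft f t N i) ∧ ∀ x, ‖approxLeft f t N i x‖ ≤ L + 1 := by
  have hm := measurable_dividedDifference hf
  have hL := L.2
  have hb : ∀ p, ‖dividedDifference f p‖ ≤ (L : ℝ) + 1 := fun p =>
    (norm_dividedDifference_le hf p).trans (by linarith)
  have h1 : ∀ x : ℝ, ‖(1 : ℝ → ℂ) x‖ ≤ (L : ℝ) + 1 := fun x => by simp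
  have hS : ∀ k, MeasurableSet (shortIntervals t N k) := fun k =>
    Finset.measurableSet_biUnion _ fun _ _ => measurableSet_Ioo
  rcases i with (p | p) | (j | k)
  · exact ⟨measurable_one.indicator (measurableSet_singleton p),
      norm_indicator_le_of_forall_le h1⟩
  · exact ⟨(hm.comp measurable_prodMk_right).indicator (Finset.measurableSet _).compl,
      norm_indicator_le_of_forall_le fun x => hb _⟩
  · exact ⟨measurable_one.indicator measurableSet_Ioo,
      norm_indicator_le_of_forall_le h1⟩
  · exact ⟨(hm.comp measurable_prodMk_right).indicator (hS k),
      norm_indicator_le_of_forall_le fun x => hb _⟩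

theorem approxRight_spec (hf : LipschitzWith L f) (t : ℕ → ℝ) (N : ℕ) (i : ApproxIndex) :
    Measurable (approxRight f t N i) ∧ ∀ x, ‖approxRight f t N i x‖ ≤ L + 1 := by
  have hm := measurable_dividedDifference hf
  have hL := L.2
  have hb : ∀ p, ‖dividedDifference f p‖ ≤ (L : ℝ) + 1 := fun p =>
    (norm_dividedDifference_le hf p).trans (by linarith)
  have h1 : ∀ x : ℝ, ‖(1 : ℝ → ℂ) x‖ ≤ (L : ℝ) + 1 := fun x => by simp
  have hS : ∀ k, MeasurableSet (longIntervals t N k) := fun k =>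
    Finset.measurableSet_biUnion _ fun _ _ => measurableSet_Ioo
  rcases i with (p | p) | (j | k)
  · exact ⟨hm.comp measurable_prodMk_left, fun x => hb _⟩
  · exact ⟨measurable_one.indicator (measurableSet_singleton p),
      norm_indicator_le_of_forall_le h1⟩
  · exact ⟨(hm.comp measurable_prodMk_left).indicator (hS j),
      norm_indicator_le_of_forall_le fun x => hb _⟩
  · exact ⟨measurable_one.indicator measurableSet_Ioo,
      norm_indicator_le_of_forall_le h1⟩

theorem sum_approx_eq (f : ℝ → ℂ) (t : ℕ → ℝ) (N : ℕ) (x y : ℝ) :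
    ∑ i ∈ approxIndices t N, approxLeft f t N i x * approxRight f t N i y
      = (∑ p ∈ (Finset.range (N + 1)).image t,
            Set.indicator {p} 1 x * dividedDifference f (p, y)
        + ∑ p ∈ (Finset.range (N + 1)).image t,
            Set.indicator (((Finset.range (N + 1)).image t : Set ℝ)ᶜ)
              (fun x => dividedDifference f (x, p)) x * Set.indicator {p} 1 y)
        + (∑ j ∈ Finset.range N, Set.indicator (Set.Ioo (t j) (t (j + 1))) 1 x *
            Set.indicator (longIntervals t N j) (fun y => dividedDifference f (t j, y)) y
        + ∑ k ∈ Finset.range N, Set.indicator (shortIntervals t N k)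
              (fun x => dividedDifference f (x, t k)) x *
            Set.indicator (Set.Ioo (t k) (t (k + 1))) 1 y) := by
  simp only [approxIndices, Finset.sum_disjSum]
  rfl

theorem notMem_longIntervals {N j : ℕ} {y : ℝ}
    (hy : ∀ k ∈ Finset.range N, y ∉ Set.Ioo (t k) (t (k + 1))) : y ∉ longIntervals t N j := by
  simp only [longIntervals, Set.mem_iUnion, not_exists]
  exact fun k hk => hy k (Finset.mem_filter.1 hk).1

theorem notMem_shortIntervals {N j : ℕ} {y : ℝ}
    (hy : ∀ k ∈ Finset.range N, y ∉ Set.Ioo (t k) (t (k + 1))) : y ∉ shortIntervals t N j := by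
  simp only [shortIntervals, Set.mem_iUnion, not_exists]
  exact fun k hk => hy k (Finset.mem_filter.1 hk).1

theorem mem_longIntervals_iff (ht : Monotone t) {N j k : ℕ} {y : ℝ} (hk : k ∈ Finset.range N)
    (hy : y ∈ Set.Ioo (t k) (t (k + 1))) :
    y ∈ longIntervals t N j ↔ ¬ t (k + 1) - t k < t (j + 1) - t j := by
  simp only [longIntervals, Set.mem_iUnion, Finset.mem_filter]
  constructor
  · rintro ⟨k', hk', hy'⟩
    rw [eq_of_mem_Ioo_of_mem_Ioo ht hy hy']
    exact hk'.2
  · exact fun h => ⟨k, ⟨hk, h⟩, hy⟩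

theorem mem_shortIntervals_iff (ht : Monotone t) {N j k : ℕ} {x : ℝ} (hj : j ∈ Finset.range N)
    (hx : x ∈ Set.Ioo (t j) (t (j + 1))) :
    x ∈ shortIntervals t N k ↔ t (k + 1) - t k < t (j + 1) - t j := by
  simp only [shortIntervals, Set.mem_iUnion, Finset.mem_filter]
  constructor
  · rintro ⟨j', hj', hx'⟩
    rw [eq_of_mem_Ioo_of_mem_Ioo ht hx hx']
    exact hj'.2
  · exact fun h => ⟨j, ⟨hj, h⟩, hx⟩

/-- The pointwise bound for the squared error of the approximation. -/
noncomputable def approxErrorBound (L : ℝ) (t : ℕ → ℝ) (N : ℕ) (p : ℝ × ℝ) : ℝ :=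
  L ^ 2 * Set.indicator ((Set.Iio (t 0) ∪ Set.Ioi (t N)) ×ˢ Set.univ) 1 p
    + L ^ 2 * Set.indicator (Set.univ ×ˢ (Set.Iio (t 0) ∪ Set.Ioi (t N))) 1 p
    + ∑ j ∈ Finset.range N, ∑ k ∈ Finset.range N,
      16 * L ^ 2 * (intervalWeight t j k + intervalWeight t k j) *
        Set.indicator (Set.Ioo (t j) (t (j + 1)) ×ˢ Set.Ioo (t k) (t (k + 1))) 1 p

/-- If a coordinate is a breakpoint, the approximation is exact; the complement in `approxLeft`
prevents counting twice when both are. Otherwise, if a coordinate lies in a tail, the approximation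
is zero and the error is at most `L`. In the remaining case the point lies in one box, where exactly
one interval term survives. -/
theorem norm_sub_sum_approx_sq_le (hf : LipschitzWith L f) (ht : Monotone t) (N : ℕ) (x y : ℝ) :
    ‖dividedDifference f (x, y)
        - ∑ i ∈ approxIndices t N, approxLeft f t N i x * approxRight f t N i y‖ ^ 2
      ≤ approxErrorBound L t N (x, y) := by
  have hnn : ∀ (S : Set (ℝ × ℝ)) (p : ℝ × ℝ), 0 ≤ Set.indicator S (1 : ℝ × ℝ → ℝ) p := fun S p =>
    Set.indicator_nonneg (fun _ _ => zero_le_one) _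
  have hw := intervalWeight_nonneg t
  have hA : 0 ≤ L ^ 2 * Set.indicator ((Set.Iio (t 0) ∪ Set.Ioi (t N)) ×ˢ Set.univ)
      (1 : ℝ × ℝ → ℝ) (x, y) := mul_nonneg (by positivity) (hnn _ _)
  have hB : 0 ≤ L ^ 2 * Set.indicator (Set.univ ×ˢ (Set.Iio (t 0) ∪ Set.Ioi (t N)))
      (1 : ℝ × ℝ → ℝ) (x, y) := mul_nonneg (by positivity) (hnn _ _)
  have hC' : ∀ j k, 0 ≤ 16 * (L : ℝ) ^ 2 * (intervalWeight t j k + intervalWeight t k j) *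
        Set.indicator (Set.Ioo (t j) (t (j + 1)) ×ˢ Set.Ioo (t k) (t (k + 1))) (1 : ℝ × ℝ → ℝ)
          (x, y) := fun j k =>
    mul_nonneg (mul_nonneg (by positivity) (add_nonneg (hw _ _) (hw _ _))) (hnn _ _)
  have hC : 0 ≤ ∑ j ∈ Finset.range N, ∑ k ∈ Finset.range N,
      16 * (L : ℝ) ^ 2 * (intervalWeight t j k + intervalWeight t k j) *
        Set.indicator (Set.Ioo (t j) (t (j + 1)) ×ˢ Set.Ioo (t k) (t (k + 1))) (1 : ℝ × ℝ → ℝ)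
          (x, y) :=
    Finset.sum_nonneg fun j _ => Finset.sum_nonneg fun k _ => hC' j k
  have hL : ‖dividedDifference f (x, y)‖ ^ 2 ≤ (L : ℝ) ^ 2 := by
    gcongr; exact norm_dividedDifference_le hf _
  rw [sum_approx_eq]
  unfold approxErrorBound
  set P := (Finset.range (N + 1)).image t with hP
  have hPJ : ∀ z ∈ P, ∀ k ∈ Finset.range N, z ∉ Set.Ioo (t k) (t (k + 1)) := by
    intro z hz k _
    obtain ⟨i, _, rfl⟩ := Finset.mem_image.1 hz
    exact notMem_Ioo_of_monotone ht i k
  have hTJ : ∀ z, z < t 0 ∨ t N < z → ∀ k ∈ Finset.range N, z ∉ Set.Ioo (t k) (t (k + 1)) := by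
    rintro z hz k hk ⟨h1, h2⟩
    have h3 := ht (Nat.zero_le k)
    have h4 : t (k + 1) ≤ t N := ht (Finset.mem_range.1 hk)
    rcases hz with h | h <;> linarith
  have sum1 : x ∈ P → ∑ p ∈ P, Set.indicator {p} (1 : ℝ → ℂ) x * dividedDifference f (p, y)
      = dividedDifference f (x, y) := fun hx => by
    rw [Finset.sum_eq_single_of_mem x hx fun b _ hb => by simp [Ne.symm hb]]
    simp
  have sum1' : x ∉ P → ∑ p ∈ P, Set.indicator {p} (1 : ℝ → ℂ) x * dividedDifference f (p, y) = 0 :=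
    fun hx => Finset.sum_eq_zero fun p hp => by
      have : x ≠ p := fun h => hx (h ▸ hp)
      simp [this]
  have sum2 : x ∈ P → ∑ p ∈ P, Set.indicator ((P : Set ℝ)ᶜ) (fun x => dividedDifference f (x, p)) x
      * Set.indicator {p} (1 : ℝ → ℂ) y = 0 := fun hx =>
    Finset.sum_eq_zero fun p hp => by simp [hx]
  have sum2' : x ∉ P → y ∈ P → ∑ p ∈ P, Set.indicator ((P : Set ℝ)ᶜ)
      (fun x => dividedDifference f (x, p)) x * Set.indicator {p} (1 : ℝ → ℂ) y
        = dividedDifference f (x, y) := fun hx hy => by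
    rw [Finset.sum_eq_single_of_mem y hy fun b _ hb => by simp [Ne.symm hb]]
    simp [hx]
  have sum2'' : y ∉ P → ∑ p ∈ P, Set.indicator ((P : Set ℝ)ᶜ)
      (fun x => dividedDifference f (x, p)) x * Set.indicator {p} (1 : ℝ → ℂ) y = 0 :=
    fun hy => Finset.sum_eq_zero fun p hp => by
      have : y ≠ p := fun h => hy (h ▸ hp)
      simp [this]
  have sum3x : (∀ k ∈ Finset.range N, x ∉ Set.Ioo (t k) (t (k + 1))) →
      ∑ j ∈ Finset.range N, Set.indicator (Set.Ioo (t j) (t (j + 1))) (1 : ℝ → ℂ) x *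
        Set.indicator (longIntervals t N j) (fun y => dividedDifference f (t j, y)) y = 0 :=
    fun h => Finset.sum_eq_zero fun j hj => by rw [Set.indicator_of_notMem (h j hj), zero_mul]
  have sum3y : (∀ k ∈ Finset.range N, y ∉ Set.Ioo (t k) (t (k + 1))) →
      ∑ j ∈ Finset.range N, Set.indicator (Set.Ioo (t j) (t (j + 1))) (1 : ℝ → ℂ) x *
        Set.indicator (longIntervals t N j) (fun y => dividedDifference f (t j, y)) y = 0 :=
    fun h => Finset.sum_eq_zero fun j _ => by
      rw [Set.indicator_of_notMem (notMem_longIntervals h), mul_zero]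
  have sum4x : (∀ k ∈ Finset.range N, x ∉ Set.Ioo (t k) (t (k + 1))) →
      ∑ k ∈ Finset.range N, Set.indicator (shortIntervals t N k)
        (fun x => dividedDifference f (x, t k)) x *
        Set.indicator (Set.Ioo (t k) (t (k + 1))) (1 : ℝ → ℂ) y = 0 :=
    fun h => Finset.sum_eq_zero fun j _ => by
      rw [Set.indicator_of_notMem (notMem_shortIntervals h), zero_mul]
  have sum4y : (∀ k ∈ Finset.range N, y ∉ Set.Ioo (t k) (t (k + 1))) →
      ∑ k ∈ Finset.range N, Set.indicator (shortIntervals t N k)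
        (fun x => dividedDifference f (x, t k)) x *
        Set.indicator (Set.Ioo (t k) (t (k + 1))) (1 : ℝ → ℂ) y = 0 :=
    fun h => Finset.sum_eq_zero fun j hj => by rw [Set.indicator_of_notMem (h j hj), mul_zero]
  by_cases hxP : x ∈ P
  · rw [sum1 hxP, sum2 hxP, sum3x (hPJ x hxP), sum4x (hPJ x hxP)]
    simp only [add_zero, sub_self, norm_zero]
    rw [zero_pow two_ne_zero]
    linarith
  by_cases hyP : y ∈ P
  · rw [sum1' hxP, sum2' hxP hyP, sum3y (hPJ y hyP), sum4y (hPJ y hyP)]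
    simp only [add_zero, zero_add, sub_self, norm_zero]
    rw [zero_pow two_ne_zero]
    linarith
  rw [sum1' hxP, sum2'' hyP, add_zero, zero_add]
  by_cases hxT : x < t 0 ∨ t N < x
  · rw [sum3x (hTJ x hxT), sum4x (hTJ x hxT), add_zero, sub_zero]
    have : Set.indicator ((Set.Iio (t 0) ∪ Set.Ioi (t N)) ×ˢ Set.univ) (1 : ℝ × ℝ → ℝ) (x, y) = 1 :=
      Set.indicator_of_mem (by simpa using hxT) _
    rw [this] at hA ⊢
    linarith
  by_cases hyT : y < t 0 ∨ t N < y
  · rw [sum3y (hTJ y hyT), sum4y (hTJ y hyT), add_zero, sub_zero]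
    have : Set.indicator (Set.univ ×ˢ (Set.Iio (t 0) ∪ Set.Ioi (t N))) (1 : ℝ × ℝ → ℝ) (x, y) = 1 :=
      Set.indicator_of_mem (by simpa using hyT) _
    rw [this] at hB ⊢
    linarith
  push Not at hxT hyT
  obtain ⟨j, hj, hxj⟩ := mem_cover (not_lt.2 hxT.1) (not_lt.2 hxT.2) hxP
  obtain ⟨k, hk, hyk⟩ := mem_cover (not_lt.2 hyT.1) (not_lt.2 hyT.2) hyP
  have hbound : 16 * (L : ℝ) ^ 2 * (intervalWeight t j k + intervalWeight t k j)
      ≤ ∑ j ∈ Finset.range N, ∑ k ∈ Finset.range N,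
      16 * (L : ℝ) ^ 2 * (intervalWeight t j k + intervalWeight t k j) *
        Set.indicator (Set.Ioo (t j) (t (j + 1)) ×ˢ Set.Ioo (t k) (t (k + 1))) (1 : ℝ × ℝ → ℝ)
          (x, y) := by
    refine le_trans ?_ (Finset.single_le_sum
      (fun j _ => Finset.sum_nonneg fun k _ => hC' j k) hj)
    refine le_trans ?_ (Finset.single_le_sum (fun k _ => hC' j k) hk)
    rw [Set.indicator_of_mem (by exact ⟨hxj, hyk⟩)]
    simp
  rw [Finset.sum_eq_single_of_mem j hj fun b _ hb => by
      rw [Set.indicator_of_notMem fun h => hb (eq_of_mem_Ioo_of_mem_Ioo ht h hxj), zero_mul],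
    Finset.sum_eq_single_of_mem k hk fun b _ hb => by
      rw [Set.indicator_of_notMem (s := Set.Ioo (t b) (t (b + 1)))
        fun h => hb (eq_of_mem_Ioo_of_mem_Ioo ht h hyk), mul_zero],
    Set.indicator_of_mem hxj, Set.indicator_of_mem hyk]
  -- The variable in the shorter interval is frozen; when that is `y`, symmetry of the divided
  -- difference reduces to the estimate for `x`.
  by_cases hjk : t (k + 1) - t k < t (j + 1) - t j
  · rw [Set.indicator_of_notMem (s := longIntervals t N j)
        (by rw [mem_longIntervals_iff ht hk hyk]; exact not_not.2 hjk),
      Set.indicator_of_mem ((mem_shortIntervals_iff ht hj hxj).2 hjk)]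
    have h1 := norm_sub_sq_le_intervalWeight hf ht hyk hxj hjk.not_gt
    rw [dividedDifference_swap y, dividedDifference_swap (t k)] at h1
    simp only [Pi.one_apply, mul_zero, zero_add, mul_one]
    have h2 := mul_nonneg (by positivity : 0 ≤ 16 * (L : ℝ) ^ 2) (hw j k)
    linarith
  · rw [Set.indicator_of_mem ((mem_longIntervals_iff ht hk hyk).2 hjk),
      Set.indicator_of_notMem (s := shortIntervals t N k)
        (by rw [mem_shortIntervals_iff ht hj hxj]; exact hjk)]
    have h1 := norm_sub_sq_le_intervalWeight hf ht hxj hyk hjk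
    simp only [Pi.one_apply, zero_mul, add_zero, one_mul]
    have h2 := mul_nonneg (by positivity : 0 ≤ 16 * (L : ℝ) ^ 2) (hw k j)
    linarith

/-- The two tail terms give `4 + 4`, and the boxes give `16 · (5 + 5) · 2 · 2 = 640`. -/
theorem integral_approxErrorBound_le {μ ν : Measure ℝ} [IsProbabilityMeasure μ]
    [IsProbabilityMeasure ν] (L : ℝ) (ht : Monotone t) {N : ℕ} (hN : 1 ≤ N)
    (h : ∀ ρ ∈ ({μ, ν} : Set (Measure ℝ)),
      (∀ i, ρ.real (Set.Ioo (t i) (t (i + 1))) ≤ 2 / N) ∧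
      ρ.real (Set.Iio (t 0)) ≤ 2 / N ∧ ρ.real (Set.Ioi (t N)) ≤ 2 / N) :
    Integrable (approxErrorBound L t N) (μ.prod ν) ∧
      ∫ p, approxErrorBound L t N p ∂(μ.prod ν) ≤ 648 * L ^ 2 / N := by
  have hN0 : (0 : ℝ) < N := by exact_mod_cast hN
  have hint : ∀ {S S' : Set ℝ}, MeasurableSet S → MeasurableSet S' → ∀ c : ℝ,
      Integrable (fun p => c * Set.indicator (S ×ˢ S') 1 p) (μ.prod ν) := fun hS hS' c =>
    ((integrable_const (1 : ℝ)).indicator (hS.prod hS')).const_mul c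
  have hval : ∀ {S S' : Set ℝ}, MeasurableSet S → MeasurableSet S' → ∀ c : ℝ,
      ∫ p, c * Set.indicator (S ×ˢ S') 1 p ∂(μ.prod ν) = c * (μ.real S * ν.real S') :=
    fun hS hS' c => by
      rw [integral_const_mul, integral_indicator_one (hS.prod hS'), measureReal_prod_prod]
  have hT : MeasurableSet (Set.Iio (t 0) ∪ Set.Ioi (t N)) := measurableSet_Iio.union measurableSet_Ioi
  have hJ : ∀ j, MeasurableSet (Set.Ioo (t j) (t (j + 1))) := fun j => measurableSet_Ioo
  have hi1 := hint hT MeasurableSet.univ (L ^ 2)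
  have hi2 := hint MeasurableSet.univ hT (L ^ 2)
  have hi3 : ∀ j k, Integrable (fun p => 16 * L ^ 2 * (intervalWeight t j k + intervalWeight t k j) *
        Set.indicator (Set.Ioo (t j) (t (j + 1)) ×ˢ Set.Ioo (t k) (t (k + 1))) 1 p) (μ.prod ν) :=
    fun j k => hint (hJ j) (hJ k) _
  have hi4 : Integrable (fun p => ∑ j ∈ Finset.range N, ∑ k ∈ Finset.range N,
      16 * L ^ 2 * (intervalWeight t j k + intervalWeight t k j) *
        Set.indicator (Set.Ioo (t j) (t (j + 1)) ×ˢ Set.Ioo (t k) (t (k + 1))) 1 p) (μ.prod ν) :=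
    integrable_finsetSum _ fun j _ => integrable_finsetSum _ fun k _ => hi3 j k
  refine ⟨(hi1.add hi2).add hi4, ?_⟩
  have htail : ∀ ρ ∈ ({μ, ν} : Set (Measure ℝ)),
      ρ.real (Set.Iio (t 0) ∪ Set.Ioi (t N)) ≤ 4 / N := fun ρ hρ => by
    obtain ⟨-, h1, h2⟩ := h ρ hρ
    refine (measureReal_union_le _ _).trans ?_
    calc _ ≤ 2 / (N : ℝ) + 2 / N := add_le_add h1 h2
      _ = _ := by ring
  have hw := intervalWeight_nonneg t
  have hJJ : ∀ j k, μ.real (Set.Ioo (t j) (t (j + 1))) * ν.real (Set.Ioo (t k) (t (k + 1)))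
      ≤ (2 / N) * (2 / N) := fun j k =>
    mul_le_mul ((h μ (by simp)).1 j) ((h ν (by simp)).1 k) measureReal_nonneg (by positivity)
  have hsum : ∑ j ∈ Finset.range N, ∑ k ∈ Finset.range N, intervalWeight t j k ≤ N * 5 := by
    refine (Finset.sum_le_sum fun j _ => sum_intervalWeight_le ht j N).trans ?_
    simp
  have hsum' : ∑ j ∈ Finset.range N, ∑ k ∈ Finset.range N, intervalWeight t k j ≤ N * 5 := by
    rw [Finset.sum_comm]; exact hsum
  have e : ∫ p, approxErrorBound L t N p ∂(μ.prod ν)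
      = L ^ 2 * (μ.real (Set.Iio (t 0) ∪ Set.Ioi (t N)) * ν.real Set.univ)
        + L ^ 2 * (μ.real Set.univ * ν.real (Set.Iio (t 0) ∪ Set.Ioi (t N)))
        + ∑ j ∈ Finset.range N, ∑ k ∈ Finset.range N,
          16 * L ^ 2 * (intervalWeight t j k + intervalWeight t k j) *
            (μ.real (Set.Ioo (t j) (t (j + 1))) * ν.real (Set.Ioo (t k) (t (k + 1)))) := by
    unfold approxErrorBound
    have hi12 : Integrable (fun p =>
        L ^ 2 * Set.indicator ((Set.Iio (t 0) ∪ Set.Ioi (t N)) ×ˢ Set.univ) 1 p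
        + L ^ 2 * Set.indicator (Set.univ ×ˢ (Set.Iio (t 0) ∪ Set.Ioi (t N))) 1 p) (μ.prod ν) :=
      hi1.add hi2
    rw [integral_add hi12 hi4, integral_add hi1 hi2, hval hT MeasurableSet.univ,
      hval MeasurableSet.univ hT,
      integral_finsetSum _ fun j _ => integrable_finsetSum _ fun k _ => hi3 j k]
    congr 1
    refine Finset.sum_congr rfl fun j _ => ?_
    rw [integral_finsetSum _ fun k _ => hi3 j k]
    exact Finset.sum_congr rfl fun k _ => hval (hJ j) (hJ k) _
  rw [e]
  have h1 : L ^ 2 * (μ.real (Set.Iio (t 0) ∪ Set.Ioi (t N)) * ν.real Set.univ)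
      ≤ L ^ 2 * (4 / N) := by
    rw [probReal_univ, mul_one]
    exact mul_le_mul_of_nonneg_left (htail μ (by simp)) (by positivity)
  have h2 : L ^ 2 * (μ.real Set.univ * ν.real (Set.Iio (t 0) ∪ Set.Ioi (t N)))
      ≤ L ^ 2 * (4 / N) := by
    rw [probReal_univ, one_mul]
    exact mul_le_mul_of_nonneg_left (htail ν (by simp)) (by positivity)
  have h3 : ∑ j ∈ Finset.range N, ∑ k ∈ Finset.range N,
          16 * L ^ 2 * (intervalWeight t j k + intervalWeight t k j) *
            (μ.real (Set.Ioo (t j) (t (j + 1))) * ν.real (Set.Ioo (t k) (t (k + 1))))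
      ≤ 16 * L ^ 2 * (N * 5 + N * 5) * ((2 / N) * (2 / N)) := by
    calc _ ≤ ∑ j ∈ Finset.range N, ∑ k ∈ Finset.range N,
          16 * L ^ 2 * (intervalWeight t j k + intervalWeight t k j) * ((2 / N) * (2 / N)) :=
          Finset.sum_le_sum fun j _ => Finset.sum_le_sum fun k _ =>
            mul_le_mul_of_nonneg_left (hJJ j k)
              (mul_nonneg (by positivity) (add_nonneg (hw _ _) (hw _ _)))
      _ = 16 * L ^ 2 * (∑ j ∈ Finset.range N, ∑ k ∈ Finset.range N, intervalWeight t j k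
            + ∑ j ∈ Finset.range N, ∑ k ∈ Finset.range N, intervalWeight t k j)
            * ((2 / N) * (2 / N)) := by
          simp only [← Finset.sum_mul, ← Finset.mul_sum, Finset.sum_add_distrib]
      _ ≤ _ := by gcongr
  have h4 : 16 * L ^ 2 * (N * 5 + N * 5) * ((2 / N) * (2 / N)) = 640 * L ^ 2 / (N : ℝ) := by
    field_simp; ring
  have h5 : L ^ 2 * (4 / N) + L ^ 2 * (4 / N) + 640 * L ^ 2 / (N : ℝ) = 648 * L ^ 2 / N := by ring
  linarith

end ProductApproximation

/-! ### Singular number bounds for the divided-difference kernel -/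

section KernelOfDividedDifference

theorem Lp_two_norm_sq_eq_integral {α : Type*} [MeasurableSpace α] {ρ : Measure α}
    (F : Lp ℂ 2 ρ) : ‖F‖ ^ 2 = ∫ x, ‖F x‖ ^ 2 ∂ρ := by
  have h := L2.inner_def (𝕜 := ℂ) F F
  simp only [inner_self_eq_norm_sq_to_K] at h
  have h2 : ∫ x, (‖F x‖ : ℂ) ^ 2 ∂ρ = ((∫ x, ‖F x‖ ^ 2 ∂ρ : ℝ) : ℂ) := by
    rw [← integral_complex_ofReal]; simp
  have h3 : ((‖F‖ ^ 2 : ℝ) : ℂ) = ((∫ x, ‖F x‖ ^ 2 ∂ρ : ℝ) : ℂ) := by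
    rw [← h2, Complex.ofReal_pow]; exact h
  exact_mod_cast h3

variable {f : ℝ → ℂ} {L : ℝ≥0}

theorem memLp_dividedDifference (hf : LipschitzWith L f) (ρ : Measure (ℝ × ℝ)) [IsFiniteMeasure ρ] :
    MemLp (dividedDifference f) 2 ρ :=
  MemLp.of_bound (measurable_dividedDifference hf).aestronglyMeasurable L
    (ae_of_all _ fun p => norm_dividedDifference_le hf p)

theorem coeFn_sum_tensorConj {ι : Type*} {μ ν : Measure ℝ} [IsFiniteMeasure μ] [IsFiniteMeasure ν]
    (s : Finset ι) (a : ι → Lp ℂ 2 μ) (b : ι → Lp ℂ 2 ν) {a' b' : ι → ℝ → ℂ}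
    (ha : ∀ i, a i =ᵐ[μ] a' i) (hb : ∀ i, b i =ᵐ[ν] fun y => star (b' i y)) :
    (∑ i ∈ s, tensorConj (a i) (b i) : Lp ℂ 2 (μ.prod ν)) =ᵐ[μ.prod ν]
      fun p => ∑ i ∈ s, a' i p.1 * b' i p.2 := by
  classical
  induction s using Finset.induction_on with
  | empty => simpa using! Lp.coeFn_zero ℂ 2 (μ.prod ν)
  | insert i s hi ih =>
    rw [Finset.sum_insert hi]
    filter_upwards [Lp.coeFn_add (tensorConj (a i) (b i)) (∑ i ∈ s, tensorConj (a i) (b i)), ih,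
      tensorConj_ae_of_ae (ha i) (hb i)] with p h1 h2 h3
    rw [h1, Pi.add_apply, h2, h3, Finset.sum_insert hi, star_star]

variable {μ ν : Measure ℝ} [IsProbabilityMeasure μ] [IsProbabilityMeasure ν]

theorem norm_toLp_dividedDifference_le (hf : LipschitzWith L f) :
    ‖(memLp_dividedDifference hf (μ.prod ν)).toLp‖ ≤ L := by
  have h := Lp_two_norm_sq_eq_integral (memLp_dividedDifference hf (μ.prod ν)).toLp
  refine le_of_sq_le_sq ?_ L.2
  rw [h]
  calc _ ≤ ∫ _p, (L : ℝ) ^ 2 ∂(μ.prod ν) := by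
        refine integral_mono_of_nonneg (ae_of_all _ fun _ => by positivity) (integrable_const _) ?_
        filter_upwards [(memLp_dividedDifference hf (μ.prod ν)).coeFn_toLp] with p hp
        simp only [hp]
        gcongr
        exact norm_dividedDifference_le hf p
    _ = _ := by simp

/-- Rank `6N` pays for the product kernels and `N` for the Hilbert–Schmidt remainder; `26` arises
from `648 ≤ 26²`. -/
theorem exists_rank_le_norm_kernelOp_dividedDifference_sub_le (hf : LipschitzWith L f) {N : ℕ}
    (hN : 1 ≤ N) :
    ∃ R : Lp ℂ 2 ν →L[ℂ] Lp ℂ 2 μ,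
      (R : Lp ℂ 2 ν →ₗ[ℂ] Lp ℂ 2 μ).rank ≤ ((7 * N : ℕ) : Cardinal) ∧
      ‖kernelOp (memLp_dividedDifference hf (μ.prod ν)).toLp - R‖ ≤ 26 * L / N := by
  have hN0 : (0 : ℝ) < N := by exact_mod_cast hN
  obtain ⟨t, ht, hμν⟩ := exists_partition_pair μ ν hN
  have ha : ∀ i, MemLp (approxLeft f t N i) 2 μ := fun i =>
    MemLp.of_bound (approxLeft_spec hf t N i).1.aestronglyMeasurable _
      (ae_of_all _ (approxLeft_spec hf t N i).2)
  have hb : ∀ i, MemLp (fun y => star (approxRight f t N i y)) 2 ν := fun i =>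
    (MemLp.of_bound (approxRight_spec hf t N i).1.aestronglyMeasurable _
      (ae_of_all _ (approxRight_spec hf t N i).2)).star
  set Φ := (memLp_dividedDifference hf (μ.prod ν)).toLp with hΦ
  obtain ⟨R, hR, hle⟩ := exists_rank_le_norm_kernelOp_sub_le Φ (approxIndices t N)
    (fun i => (ha i).toLp) (fun i => (hb i).toLp) N
  refine ⟨R, hR.trans ?_, hle.trans ?_⟩
  · exact_mod_cast (by linarith [card_approxIndices_le t hN] :
      (approxIndices t N).card + N ≤ 7 * N)
  set Ψ := ∑ i ∈ approxIndices t N, tensorConj (ha i).toLp (hb i).toLp with hΨ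
  have hsq : ‖Φ - Ψ‖ ^ 2 ≤ 648 * L ^ 2 / N := by
    obtain ⟨hint, hbound⟩ := integral_approxErrorBound_le (μ := μ) (ν := ν) L ht hN hμν
    rw [Lp_two_norm_sq_eq_integral]
    refine (integral_mono_of_nonneg (ae_of_all _ fun _ => by positivity) hint ?_).trans hbound
    filter_upwards [Lp.coeFn_sub Φ Ψ, (memLp_dividedDifference hf (μ.prod ν)).coeFn_toLp,
      coeFn_sum_tensorConj (approxIndices t N) (fun i => (ha i).toLp) (fun i => (hb i).toLp)
        (fun i => (ha i).coeFn_toLp) (fun i => (hb i).coeFn_toLp)] with p h1 h2 h3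
    rw [h1, Pi.sub_apply, hΨ, h3, hΦ, h2]
    exact norm_sub_sum_approx_sq_le hf ht N p.1 p.2
  refine le_of_sq_le_sq ?_ (by positivity)
  rw [div_pow, Real.sq_sqrt (by positivity), div_pow, div_le_div_iff₀ (by positivity) (by positivity)]
  rw [le_div_iff₀ hN0] at hsq
  have h1 : ‖Φ - Ψ‖ ^ 2 * N ^ 2 ≤ 648 * L ^ 2 * N := by nlinarith
  have h2 : 0 ≤ (L : ℝ) ^ 2 * N := by positivity
  have h3 : 0 ≤ (L : ℝ) ^ 2 := by positivity
  nlinarith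

/-- Take `N = j / 7`; then `1 + j ≤ 14 N` and `364 = 26 · 14`. For `j < 7` the zero operator
suffices. -/
theorem exists_rank_le_norm_kernelOp_dividedDifference_sub_mul_le (hf : LipschitzWith L f) (j : ℕ) :
    ∃ R : Lp ℂ 2 ν →L[ℂ] Lp ℂ 2 μ, (R : Lp ℂ 2 ν →ₗ[ℂ] Lp ℂ 2 μ).rank ≤ (j : Cardinal) ∧
      ‖kernelOp (memLp_dividedDifference hf (μ.prod ν)).toLp - R‖ * (1 + j) ≤ 364 * L := by
  have hL := L.2
  rcases lt_or_ge j 7 with hj | hj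
  · refine ⟨0, ?_, ?_⟩
    · simp
    · rw [sub_zero]
      have h1 := (norm_kernelOp_le _).trans (norm_toLp_dividedDifference_le (μ := μ) (ν := ν) hf)
      have h2 : (j : ℝ) ≤ 6 := by exact_mod_cast (by omega : j ≤ 6)
      calc _ ≤ (L : ℝ) * (1 + 6) := by gcongr
        _ ≤ _ := by linarith
  · obtain ⟨R, hR, hle⟩ := exists_rank_le_norm_kernelOp_dividedDifference_sub_le (μ := μ) (ν := ν) hf
      (N := j / 7) (by omega)
    refine ⟨R, hR.trans (by exact_mod_cast (by omega : 7 * (j / 7) ≤ j)), ?_⟩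
    have hN0 : (0 : ℝ) < (j / 7 : ℕ) := by exact_mod_cast (by omega : 0 < j / 7)
    have h2 : (1 + j : ℝ) ≤ 14 * (j / 7 : ℕ) := by exact_mod_cast (by omega : 1 + j ≤ 14 * (j / 7))
    calc _ ≤ 26 * (L : ℝ) / (j / 7 : ℕ) * (14 * (j / 7 : ℕ)) := by gcongr
      _ = _ := by field_simp; ring

end KernelOfDividedDifference

/-! ### Ideal property of the weak trace quasinorm -/

section SingularNumbers

variable {H₁ H₂ X Y : Type*} [NormedAddCommGroup H₁] [InnerProductSpace ℂ H₁]
  [NormedAddCommGroup H₂] [InnerProductSpace ℂ H₂]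
  [NormedAddCommGroup X] [InnerProductSpace ℂ X] [NormedAddCommGroup Y] [InnerProductSpace ℂ Y]

theorem rank_comp_comp_le (V : Y →L[ℂ] H₁) (R : X →L[ℂ] Y) (W : H₂ →L[ℂ] X) {j : ℕ}
    (hR : (R : X →ₗ[ℂ] Y).rank ≤ (j : Cardinal)) :
    ((V ∘L R ∘L W : H₂ →L[ℂ] H₁) : H₂ →ₗ[ℂ] H₁).rank ≤ (j : Cardinal) := by
  have h1 : ((R ∘L W : H₂ →L[ℂ] Y) : H₂ →ₗ[ℂ] Y).rank ≤ (j : Cardinal) :=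
    (LinearMap.rank_comp_le_left (W : H₂ →ₗ[ℂ] X) (R : X →ₗ[ℂ] Y)).trans hR
  -- `Y` and `H₁` may lie in different universes, so the ranks are compared after lifting.
  have h2 := LinearMap.lift_rank_comp_le_right ((R ∘L W : H₂ →L[ℂ] Y) : H₂ →ₗ[ℂ] Y)
    (V : Y →ₗ[ℂ] H₁)
  have h3 := h2.trans (Cardinal.lift_le.2 h1)
  rw [Cardinal.lift_natCast, Cardinal.lift_le_nat_iff] at h3
  exact h3

theorem weakTraceQuasinorm_comp_comp_le (V : Y →L[ℂ] H₁) (K : X →L[ℂ] Y) (W : H₂ →L[ℂ] X)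
    {c : ℝ} (hV : ‖V‖ ≤ c) (hW : ‖W‖ ≤ 1) {C : ℝ}
    (hK : ∀ j : ℕ, ∃ R : X →L[ℂ] Y, (R : X →ₗ[ℂ] Y).rank ≤ (j : Cardinal) ∧
      ‖K - R‖ * (1 + j) ≤ C) :
    weakTraceQuasinorm (V ∘L K ∘L W) ≤ ENNReal.ofReal (c * C) := by
  have hc : 0 ≤ c := (norm_nonneg V).trans hV
  refine iSup_le fun j => ?_
  obtain ⟨R, hR, hle⟩ := hK j
  have h1 : singularNumber (V ∘L K ∘L W) j ≤ ‖V ∘L K ∘L W - V ∘L R ∘L W‖ₑ :=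
    iInf₂_le (V ∘L R ∘L W) (rank_comp_comp_le V R W hR)
  have h2 : ‖V ∘L K ∘L W - V ∘L R ∘L W‖ ≤ c * ‖K - R‖ := by
    have : V ∘L K ∘L W - V ∘L R ∘L W = V ∘L (K - R) ∘L W := by
      ext x; simp
    rw [this]
    calc _ ≤ ‖V‖ * (‖K - R‖ * ‖W‖) := (ContinuousLinearMap.opNorm_comp_le _ _).trans
          (mul_le_mul_of_nonneg_left (ContinuousLinearMap.opNorm_comp_le _ _) (norm_nonneg _))
      _ ≤ c * (‖K - R‖ * 1) := by gcongr
      _ = _ := by ring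
  have h3 : (1 + (j : ℝ≥0∞)) = ENNReal.ofReal (1 + j) := by
    rw [ENNReal.ofReal_add zero_le_one (by positivity)]; simp
  calc _ ≤ ENNReal.ofReal (c * ‖K - R‖) * (1 + (j : ℝ≥0∞)) := by
        gcongr
        refine h1.trans ?_
        rw [← ofReal_norm]
        exact ENNReal.ofReal_le_ofReal h2
    _ = ENNReal.ofReal (c * (‖K - R‖ * (1 + j))) := by
        rw [h3, ← ENNReal.ofReal_mul (by positivity), mul_assoc]
    _ ≤ _ := ENNReal.ofReal_le_ofReal (mul_le_mul_of_nonneg_left hle hc)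

end SingularNumbers

/-! ### Integration against complex measures with density -/

section VectorMeasureIntegral

/-- The formula holds on simple functions by linearity; dominated convergence along uniformly
bounded simple approximants then applies to both sides. -/
theorem integrable_and_integral_withDensityᵥ {X : Type*} [MeasurableSpace X] {ρ : Measure X}
    {r : X → ℂ} (hr : Integrable r ρ) {Φ : X → ℂ} (hΦ : Measurable Φ) {C : ℝ}
    (hC : ∀ x, ‖Φ x‖ ≤ C) :
    VectorMeasure.Integrable (ρ.withDensityᵥ r) Φ ∧
      VectorMeasure.integral (ρ.withDensityᵥ r) Φ (ContinuousLinearMap.mul ℝ ℂ)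
        = ∫ x, Φ x * r x ∂ρ := by
  have hvar := Measure.variation_withDensityᵥ hr
  have hfin : IsFiniteMeasure (ρ.withDensityᵥ r).variation := by
    rw [hvar]
    exact ⟨by simpa using! hr.2⟩
  have hint : ∀ {Ψ : X → ℂ} {D : ℝ}, Measurable Ψ → (∀ x, ‖Ψ x‖ ≤ D) →
      VectorMeasure.Integrable (ρ.withDensityᵥ r) Ψ := fun hΨ hD =>
    Integrable.of_bound hΨ.aestronglyMeasurable _ (ae_of_all _ hD)
  have hint' : ∀ {Ψ : X → ℂ} {D : ℝ}, Measurable Ψ → (∀ x, ‖Ψ x‖ ≤ D) →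
      Integrable (fun x => Ψ x * r x) ρ := fun hΨ hD =>
    hr.bdd_mul hΨ.aestronglyMeasurable (ae_of_all _ hD)
  refine ⟨hint hΦ hC, ?_⟩
  have hsimple : ∀ φ : SimpleFunc X ℂ,
      VectorMeasure.integral (ρ.withDensityᵥ r) φ (ContinuousLinearMap.mul ℝ ℂ)
        = ∫ x, φ x * r x ∂ρ := by
    intro φ
    induction φ using SimpleFunc.induction with
    | @const c s hs =>
      have e : (SimpleFunc.piecewise s hs (SimpleFunc.const X c) (SimpleFunc.const X 0) : X → ℂ)
          = s.indicator fun _ => c := by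
        ext x; simp [SimpleFunc.coe_piecewise, Set.piecewise, Set.indicator]
      rw [e, VectorMeasure.integral_indicator_const c hs, withDensityᵥ_apply hr hs,
        ContinuousLinearMap.mul_apply', ← integral_const_mul, ← integral_indicator hs]
      refine integral_congr_ae (ae_of_all _ fun x => ?_)
      by_cases hx : x ∈ s <;> simp [hx]
    | @add φ ψ _ hφ hψ =>
      obtain ⟨D, hD⟩ := φ.exists_forall_norm_le
      obtain ⟨D', hD'⟩ := ψ.exists_forall_norm_le
      rw [SimpleFunc.coe_add, VectorMeasure.integral_add (hint φ.measurable hD)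
        (hint ψ.measurable hD'), hφ, hψ, ← integral_add (hint' φ.measurable hD)
        (hint' ψ.measurable hD')]
      refine integral_congr_ae (ae_of_all _ fun x => ?_)
      simp [add_mul]
  have hsm := hΦ.stronglyMeasurable
  have hb : ∀ n x, ‖hsm.approxBounded C n x‖ ≤ C := fun n x =>
    hsm.norm_approxBounded_le ((norm_nonneg _).trans (hC x)) n x
  have hlim : ∀ x, Filter.Tendsto (fun n => hsm.approxBounded C n x) Filter.atTop (nhds (Φ x)) :=
    fun x => hsm.tendsto_approxBounded_of_norm_le (hC x)
  have h1 : Filter.Tendsto (fun n => VectorMeasure.integral (ρ.withDensityᵥ r)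
      (hsm.approxBounded C n) (ContinuousLinearMap.mul ℝ ℂ)) Filter.atTop
      (nhds (VectorMeasure.integral (ρ.withDensityᵥ r) Φ (ContinuousLinearMap.mul ℝ ℂ))) :=
    VectorMeasure.tendsto_integral_of_dominated_convergence (fun _ => C)
      (fun n => (SimpleFunc.measurable _).aestronglyMeasurable) (integrable_const C)
      (fun n => ae_of_all _ (hb n)) (ae_of_all _ hlim)
  have h2 := tendsto_integral_of_dominated_convergence (μ := ρ)
    (F := fun n x => hsm.approxBounded C n x * r x) (f := fun x => Φ x * r x)
    (fun x => C * ‖r x‖) (fun n => (hint' (SimpleFunc.measurable _) (hb n)).aestronglyMeasurable)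
    (hr.norm.const_mul C)
    (fun n => ae_of_all _ fun x => by
      rw [norm_mul]; exact mul_le_mul_of_nonneg_right (hb n x) (norm_nonneg _))
    (ae_of_all _ fun x => (hlim x).mul_const _)
  simp only [hsimple] at h1
  exact tendsto_nhds_unique h1 h2

theorem complexMeasure_prod_ext {m m' : ComplexMeasure (ℝ × ℝ)}
    (h : ∀ Λ Δ : Set ℝ, MeasurableSet Λ → MeasurableSet Δ → m (Λ ×ˢ Δ) = m' (Λ ×ˢ Δ)) : m = m' := by
  refine VectorMeasure.ext_of_generateFrom _ ?_ generateFrom_prod.symm isPiSystem_prod ?_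
  · rintro _ ⟨Λ, hΛ, Δ, hΔ, rfl⟩
    exact h Λ Δ hΛ hΔ
  · rw [← Set.univ_prod_univ]
    exact h _ _ MeasurableSet.univ MeasurableSet.univ

end VectorMeasureIntegral

/-! ### Uniqueness of the double operator integral -/

section DoubleOperatorIntegral

variable {H₁ H₂ : Type*} [NormedAddCommGroup H₁] [InnerProductSpace ℂ H₁] [CompleteSpace H₁]
  [NormedAddCommGroup H₂] [InnerProductSpace ℂ H₂] [CompleteSpace H₂]

theorem IsDoubleOperatorIntegral.unique {E₁ : BorelSpectralMeasure H₁}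
    {E₂ : BorelSpectralMeasure H₂} {Φ : ℝ × ℝ → ℂ} {T Q Q' : H₂ →L[ℂ] H₁}
    (hQ : IsDoubleOperatorIntegral E₁ E₂ Φ T Q) (hQ' : IsDoubleOperatorIntegral E₁ E₂ Φ T Q') :
    Q' = Q := by
  ext1 g
  refine ext_inner_left ℂ fun h => ?_
  obtain ⟨m, hm, -, e⟩ := hQ g h
  obtain ⟨m', hm', -, e'⟩ := hQ' g h
  rw [e, e', complexMeasure_prod_ext fun Λ Δ hΛ hΔ => (hm' Λ Δ hΛ hΔ).trans (hm Λ Δ hΛ hΔ).symm]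

end DoubleOperatorIntegral

/-! ### Scalar spectral measures and their `L²` spaces -/

section SpectralMeasure

variable {H : Type*} [NormedAddCommGroup H] [InnerProductSpace ℂ H] [CompleteSpace H]
  (E : BorelSpectralMeasure H)

theorem BorelSpectralMeasure.inner_proj_left {Λ : Set ℝ} (hΛ : MeasurableSet Λ) (u v : H) :
    inner ℂ (E.proj Λ u) v = inner ℂ u (E.proj Λ v) := by
  have h := (E.isStarProjection Λ hΛ).isSelfAdjoint
  rw [ContinuousLinearMap.isSelfAdjoint_iff_isSymmetric] at h
  exact h u v

theorem BorelSpectralMeasure.inner_proj_proj {Λ Δ : Set ℝ} (hΛ : MeasurableSet Λ)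
    (hΔ : MeasurableSet Δ) (u v : H) :
    inner ℂ (E.proj Λ u) (E.proj Δ v) = inner ℂ u (E.proj (Λ ∩ Δ) v) := by
  rw [E.inner_proj_left hΛ, E.proj_inter Λ Δ hΛ hΔ]
  rfl

theorem BorelSpectralMeasure.inner_proj_self {Λ : Set ℝ} (hΛ : MeasurableSet Λ) (u : H) :
    inner ℂ u (E.proj Λ u) = ((‖E.proj Λ u‖ ^ 2 : ℝ) : ℂ) := by
  have h := E.inner_proj_proj hΛ hΛ u u
  rw [Set.inter_self, inner_self_eq_norm_sq_to_K] at h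
  rw [← h]
  simp

theorem BorelSpectralMeasure.hasSum_norm_sq {Λ : ℕ → Set ℝ} (hΛ : ∀ i, MeasurableSet (Λ i))
    (hd : Pairwise (Function.onFun Disjoint Λ)) (u : H) :
    HasSum (fun i => ‖E.proj (Λ i) u‖ ^ 2) (‖E.proj (⋃ i, Λ i) u‖ ^ 2) := by
  have h := (E.hasSum_iUnion Λ hΛ hd u).mapL (innerSL ℂ u)
  simp only [innerSL_apply_apply, E.inner_proj_self (hΛ _),
    E.inner_proj_self (MeasurableSet.iUnion hΛ)] at h
  exact_mod_cast h

/-- The scalar spectral measure `Λ ↦ ‖E(Λ) u‖²`. -/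
noncomputable def BorelSpectralMeasure.scalar (u : H) : Measure ℝ :=
  Measure.ofMeasurable (fun Λ _ => ENNReal.ofReal (‖E.proj Λ u‖ ^ 2)) (by simp [E.proj_empty])
    fun Λ hΛ hd => by
      have h := E.hasSum_norm_sq hΛ hd u
      rw [← h.tsum_eq, ENNReal.ofReal_tsum_of_nonneg (fun _ => by positivity) h.summable]

theorem BorelSpectralMeasure.scalar_apply (u : H) {Λ : Set ℝ} (hΛ : MeasurableSet Λ) :
    E.scalar u Λ = ENNReal.ofReal (‖E.proj Λ u‖ ^ 2) :=
  Measure.ofMeasurable_apply Λ hΛ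

theorem BorelSpectralMeasure.scalar_real_apply (u : H) {Λ : Set ℝ} (hΛ : MeasurableSet Λ) :
    (E.scalar u).real Λ = ‖E.proj Λ u‖ ^ 2 := by
  rw [measureReal_def, E.scalar_apply u hΛ, ENNReal.toReal_ofReal (by positivity)]

theorem BorelSpectralMeasure.isProbabilityMeasure_scalar {u : H} (hu : ‖u‖ = 1) :
    IsProbabilityMeasure (E.scalar u) :=
  ⟨by simp [E.scalar_apply u MeasurableSet.univ, E.proj_univ, hu]⟩

theorem dense_span_indicatorConstLp {α : Type*} [MeasurableSpace α] (μ : Measure α)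
    [IsFiniteMeasure μ] :
    Dense (Submodule.span ℂ (Set.range fun Λ : {Λ : Set α // MeasurableSet Λ} =>
      (indicatorConstLp 2 Λ.2 (measure_ne_top μ _) 1 : Lp ℂ 2 μ)) : Set (Lp ℂ 2 μ)) := by
  rw [Submodule.dense_iff_topologicalClosure_eq_top, Submodule.eq_top_iff']
  set S := Submodule.span ℂ (Set.range fun Λ : {Λ : Set α // MeasurableSet Λ} =>
      (indicatorConstLp 2 Λ.2 (measure_ne_top μ _) 1 : Lp ℂ 2 μ))
  refine Lp.induction (by simp) (fun F => F ∈ S.topologicalClosure) ?_ ?_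
    S.isClosed_topologicalClosure
  · intro c Λ hΛ hμ
    have h : (Lp.simpleFunc.indicatorConst 2 hΛ hμ.ne c : Lp ℂ 2 μ)
        = c • indicatorConstLp 2 hΛ (measure_ne_top μ _) 1 := by
      rw [Lp.simpleFunc.coe_indicatorConst]
      ext1
      filter_upwards [indicatorConstLp_coeFn (p := 2) (hs := hΛ) (hμs := hμ.ne) (c := c),
        indicatorConstLp_coeFn (p := 2) (hs := hΛ) (hμs := measure_ne_top μ Λ) (c := (1 : ℂ)),
        Lp.coeFn_smul c (indicatorConstLp 2 hΛ (measure_ne_top μ Λ) (1 : ℂ))] with x h1 h2 h3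
      rw [h1, h3, Pi.smul_apply, h2]
      by_cases hx : x ∈ Λ <;> simp [hx]
    rw [h]
    exact S.le_topologicalClosure (S.smul_mem c (Submodule.subset_span ⟨⟨Λ, hΛ⟩, rfl⟩))
  · intro f g hf hg _ h1 h2
    exact S.topologicalClosure.add_mem h1 h2

end SpectralMeasure

section SpectralContraction

variable {H : Type*} [NormedAddCommGroup H] [InnerProductSpace ℂ H] [CompleteSpace H]
  (E : BorelSpectralMeasure H)

/-- This is `φ ↦ (∫ φ dE) u`: both Gram matrices have entries `‖E(Λ ∩ Δ) u‖²`, and indicators span a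
dense subspace. -/
theorem BorelSpectralMeasure.exists_contraction {u : H} [IsFiniteMeasure (E.scalar u)] :
    ∃ V : Lp ℂ 2 (E.scalar u) →L[ℂ] H, ‖V‖ ≤ 1 ∧ ∀ (Λ : Set ℝ) (hΛ : MeasurableSet Λ),
      V (indicatorConstLp 2 hΛ (measure_ne_top _ _) 1) = E.proj Λ u := by
  obtain ⟨V, hV, hVE⟩ := exists_contraction_of_inner_eq
    (fun Λ : {Λ : Set ℝ // MeasurableSet Λ} =>
      (indicatorConstLp 2 Λ.2 (measure_ne_top (E.scalar u) _) 1 : Lp ℂ 2 (E.scalar u)))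
    (fun Λ => E.proj Λ u)
    (fun Λ Δ => by
      rw [L2.inner_indicatorConstLp_one_indicatorConstLp_one, E.inner_proj_proj Λ.2 Δ.2,
        E.inner_proj_self (Λ.2.inter Δ.2), E.scalar_real_apply u (Λ.2.inter Δ.2)]
      rfl)
    (dense_span_indicatorConstLp _)
  exact ⟨V, hV, fun Λ hΛ => hVE ⟨Λ, hΛ⟩⟩

/-- Thus `V* h` is the density of `Λ ↦ ⟨E(Λ)u, h⟩` with respect to the scalar measure, which makes
the measure on rectangles explicit. -/
theorem BorelSpectralMeasure.setIntegral_adjoint_apply {u : H} [IsFiniteMeasure (E.scalar u)]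
    {V : Lp ℂ 2 (E.scalar u) →L[ℂ] H}
    (hV : ∀ (Λ : Set ℝ) (hΛ : MeasurableSet Λ),
      V (indicatorConstLp 2 hΛ (measure_ne_top _ _) 1) = E.proj Λ u)
    (h : H) {Λ : Set ℝ} (hΛ : MeasurableSet Λ) :
    ∫ x in Λ, (ContinuousLinearMap.adjoint V h) x ∂(E.scalar u) = inner ℂ (E.proj Λ u) h := by
  rw [← L2.inner_indicatorConstLp_one hΛ (measure_ne_top _ _),
    ContinuousLinearMap.adjoint_inner_right, hV]

end SpectralContraction

theorem lipSeminorm_ne_top {f : ℝ → ℂ} {K : ℝ≥0} (hf : LipschitzWith K f) : lipSeminorm f ≠ ∞ := by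
  refine ne_top_of_le_ne_top (ENNReal.coe_ne_top (r := K)) (iSup₂_le fun x y => iSup_le fun hxy => ?_)
  rw [← ENNReal.ofReal_coe_nnreal]
  refine ENNReal.ofReal_le_ofReal ?_
  rw [div_le_iff₀ (abs_pos.2 (sub_ne_zero.2 hxy))]
  simpa [dist_eq_norm] using hf.dist_le_mul x y

theorem lipschitzWith_lipSeminorm {f : ℝ → ℂ} {K : ℝ≥0} (hf : LipschitzWith K f) :
    LipschitzWith (lipSeminorm f).toNNReal f := by
  refine LipschitzWith.of_dist_le_mul fun x y => ?_
  by_cases hxy : x = y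
  · simp [hxy]
  have hpos : 0 < |x - y| := abs_pos.2 (sub_ne_zero.2 hxy)
  have h : ENNReal.ofReal (‖f x - f y‖ / |x - y|) ≤ lipSeminorm f :=
    le_iSup₂_of_le x y (le_iSup_of_le hxy le_rfl)
  rw [ENNReal.ofReal_le_iff_le_toReal (lipSeminorm_ne_top hf), div_le_iff₀ hpos] at h
  simpa [dist_eq_norm] using! h

/-! ### Rank-one operators and the factorisation of `Q` -/

section RankOne

variable {H₁ H₂ : Type*} [NormedAddCommGroup H₁] [InnerProductSpace ℂ H₁] [CompleteSpace H₁]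
  [NormedAddCommGroup H₂] [InnerProductSpace ℂ H₂] [CompleteSpace H₂]

/-- Take `u` a unit vector spanning the range, `c = ‖T* u‖` and `v` the normalised `T* u`. -/
theorem exists_eq_smul_of_rank_eq_one (T : H₂ →L[ℂ] H₁) (hT : (T : H₂ →ₗ[ℂ] H₁).rank = 1) :
    ∃ (c : ℝ) (u : H₁) (v : H₂), 0 ≤ c ∧ c ≤ ‖T‖ ∧ ‖u‖ = 1 ∧ ‖v‖ = 1 ∧
      ∀ g, T g = ((c : ℂ) * inner ℂ v g) • u := by
  obtain ⟨w, ⟨x, hx⟩, hw0, hle⟩ := (rank_submodule_eq_one_iff _).1 hT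
  have hw : ‖w‖ ≠ 0 := norm_ne_zero_iff.2 hw0
  set u : H₁ := (‖w‖⁻¹ : ℂ) • w with hu
  have hu1 : ‖u‖ = 1 := by simp [hu, norm_smul, hw]
  have hTu : ∀ g, T g = inner ℂ (ContinuousLinearMap.adjoint T u) g • u := by
    intro g
    obtain ⟨a, ha⟩ := Submodule.mem_span_singleton.1 (hle ⟨g, rfl⟩)
    have hwu : w = (‖w‖ : ℂ) • u := by
      rw [hu, smul_smul, mul_inv_cancel₀ (by exact_mod_cast hw), one_smul]
    have hTg : T g = (a * ‖w‖) • u := by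
      rw [mul_smul, ← hwu]; exact ha.symm
    rw [ContinuousLinearMap.adjoint_inner_left, hTg, inner_smul_right, inner_self_eq_norm_sq_to_K,
      hu1]
    simp
  set z := ContinuousLinearMap.adjoint T u with hz
  have hz0 : ‖z‖ ≠ 0 := by
    rw [norm_ne_zero_iff]
    intro h0
    have h1 := hTu x
    rw [h0, inner_zero_left, zero_smul] at h1
    exact hw0 (hx.symm.trans h1)
  refine ⟨‖z‖, u, (‖z‖⁻¹ : ℂ) • z, norm_nonneg _, ?_, hu1, by simp [norm_smul, hz0], fun g => ?_⟩
  · have h1 := (ContinuousLinearMap.adjoint T).le_opNorm u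
    rwa [hu1, mul_one, LinearIsometryEquiv.norm_map] at h1
  · rw [hTu g, inner_smul_left, ← mul_assoc, map_inv₀, Complex.conj_ofReal,
      mul_inv_cancel₀ (by exact_mod_cast hz0), one_mul]

/-- With `φ = V* h` and `ψ = W* g`, the measure has density `c · conj (φ x) · ψ y` with respect to
the product of the scalar measures. Integrating `Φ` against it gives `c ⟨φ, K ψ⟩`, `K` being the
operator with kernel `Φ`. -/
theorem isDoubleOperatorIntegral_of_rank_one {E₁ : BorelSpectralMeasure H₁}
    {E₂ : BorelSpectralMeasure H₂} {u : H₁} {v : H₂} [IsFiniteMeasure (E₁.scalar u)]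
    [IsFiniteMeasure (E₂.scalar v)] {V : Lp ℂ 2 (E₁.scalar u) →L[ℂ] H₁}
    (hV : ∀ (Λ : Set ℝ) (hΛ : MeasurableSet Λ),
      V (indicatorConstLp 2 hΛ (measure_ne_top _ _) 1) = E₁.proj Λ u)
    {W : Lp ℂ 2 (E₂.scalar v) →L[ℂ] H₂}
    (hW : ∀ (Δ : Set ℝ) (hΔ : MeasurableSet Δ),
      W (indicatorConstLp 2 hΔ (measure_ne_top _ _) 1) = E₂.proj Δ v)
    {T : H₂ →L[ℂ] H₁} {c : ℂ} (hT : ∀ g, T g = (c * inner ℂ v g) • u)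
    {Φ : ℝ × ℝ → ℂ} (hΦ : Measurable Φ) {C : ℝ} (hC : ∀ p, ‖Φ p‖ ≤ C)
    (hΦ2 : MemLp Φ 2 ((E₁.scalar u).prod (E₂.scalar v))) :
    IsDoubleOperatorIntegral E₁ E₂ Φ T
      ((c • V) ∘L kernelOp hΦ2.toLp ∘L ContinuousLinearMap.adjoint W) := by
  intro g h
  set φ := ContinuousLinearMap.adjoint V h with hφ
  set ψ := ContinuousLinearMap.adjoint W g with hψ
  have hφi : Integrable (fun x => star (φ x)) (E₁.scalar u) :=
    (Lp.memLp φ).star.integrable one_le_two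
  have hψi : Integrable ψ (E₂.scalar v) := (Lp.memLp ψ).integrable one_le_two
  have hr : Integrable (fun p : ℝ × ℝ => c * (star (φ p.1) * ψ p.2))
      ((E₁.scalar u).prod (E₂.scalar v)) := (hφi.mul_prod hψi).const_mul c
  obtain ⟨hint, hval⟩ := integrable_and_integral_withDensityᵥ hr hΦ hC
  refine ⟨_, fun Λ Δ hΛ hΔ => ?_, hint, ?_⟩
  · rw [withDensityᵥ_apply hr (hΛ.prod hΔ), integral_const_mul,
      setIntegral_prod_mul (fun x => star (φ x)) (fun y => ψ y),
      E₂.setIntegral_adjoint_apply hW g hΔ]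
    have h1 : ∫ x in Λ, star (φ x) ∂(E₁.scalar u) = inner ℂ h (E₁.proj Λ u) := by
      rw [← inner_conj_symm, ← E₁.setIntegral_adjoint_apply hV h hΛ]
      exact integral_conj
    rw [h1, hT, map_smul, inner_smul_right, E₂.inner_proj_left hΔ]
    ring
  · rw [hval]
    have h1 : inner ℂ h (((c • V) ∘L kernelOp hΦ2.toLp ∘L ContinuousLinearMap.adjoint W) g)
        = c * inner ℂ φ (kernelOp hΦ2.toLp ψ) := by
      rw [hφ, ContinuousLinearMap.adjoint_inner_left]
      simp [hψ]
    rw [h1, inner_kernelOp, L2.inner_def, ← integral_const_mul]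
    refine integral_congr_ae ?_
    filter_upwards [coeFn_tensorConj φ ψ, hΦ2.coeFn_toLp] with p h2 h3
    rw [h2, h3]
    simp only [RCLike.inner_apply, map_mul, RCLike.star_def, Complex.conj_conj]
    ring

end RankOne

theorem mainTheorem2 :
    ∃ C : ℝ≥0,
      ∀ (H₁ H₂ : Type*) [NormedAddCommGroup H₁] [InnerProductSpace ℂ H₁] [CompleteSpace H₁]
        [NormedAddCommGroup H₂] [InnerProductSpace ℂ H₂] [CompleteSpace H₂]
        (E₁ : BorelSpectralMeasure H₁) (E₂ : BorelSpectralMeasure H₂)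
        (f : ℝ → ℂ) (_ : ∃ K : ℝ≥0, LipschitzWith K f)
        (T : H₂ →L[ℂ] H₁) (_ : (T : H₂ →ₗ[ℂ] H₁).rank = 1),
        ∃ Q : H₂ →L[ℂ] H₁,
          IsDoubleOperatorIntegral E₁ E₂ (dividedDifference f) T Q ∧
          (∀ Q' : H₂ →L[ℂ] H₁,
            IsDoubleOperatorIntegral E₁ E₂ (dividedDifference f) T Q' → Q' = Q) ∧
          MemWeakTraceClass Q ∧
          weakTraceQuasinorm Q ≤ (C : ℝ≥0∞) * lipSeminorm f * ‖T‖ₑ := by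
  refine ⟨364, ?_⟩
  intro H₁ H₂ _ _ _ _ _ _ E₁ E₂ f hfK T hT
  obtain ⟨K, hK⟩ := hfK
  have hf := lipschitzWith_lipSeminorm hK
  obtain ⟨c, u, v, hc0, hcT, hu, hv, hTg⟩ := exists_eq_smul_of_rank_eq_one T hT
  have := E₁.isProbabilityMeasure_scalar hu
  have := E₂.isProbabilityMeasure_scalar hv
  obtain ⟨V, hV1, hV⟩ := E₁.exists_contraction (u := u)
  obtain ⟨W, hW1, hW⟩ := E₂.exists_contraction (u := v)
  have hQ := isDoubleOperatorIntegral_of_rank_one hV hW hTg (measurable_dividedDifference hf)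
    (norm_dividedDifference_le hf) (memLp_dividedDifference hf _)
  have hcV : ‖(c : ℂ) • V‖ ≤ c := by
    rw [norm_smul, Complex.norm_real, Real.norm_of_nonneg hc0]
    exact mul_le_of_le_one_right hc0 hV1
  have hW1' : ‖ContinuousLinearMap.adjoint W‖ ≤ 1 := by
    rwa [LinearIsometryEquiv.norm_map]
  have hle := weakTraceQuasinorm_comp_comp_le ((c : ℂ) • V) _ (ContinuousLinearMap.adjoint W) hcV
    hW1' (exists_rank_le_norm_kernelOp_dividedDifference_sub_mul_le (μ := E₁.scalar u)
      (ν := E₂.scalar v) hf)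
  refine ⟨_, hQ, fun Q' hQ' => hQ.unique hQ', hle.trans_lt ENNReal.ofReal_lt_top, hle.trans ?_⟩
  calc _ ≤ ENNReal.ofReal (‖T‖ * (364 * (lipSeminorm f).toNNReal)) := by gcongr
    _ = _ := by
      rw [ENNReal.ofReal_mul (norm_nonneg _), ENNReal.ofReal_mul (by norm_num),
        ENNReal.ofReal_coe_nnreal, ENNReal.coe_toNNReal (lipSeminorm_ne_top hK), ofReal_norm,
        mul_comm]
      norm_num
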